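/- An $\mathbb{R}$-tree is a geodesic metric space in which the union of two segments meeting in exactly one point, an endpoint of both, is a segment, and the intersection of two segments with a common endpoint is a segment. It has valence $\kappa$ if for every point $x$ the set of geodesic-connected components of the complement of $x$ has cardinality $\kappa$. The complete (non-empty) $\mathbb{R}$-tree with valence $2^{\aleph_0}$ is called universal. An action of a group $G$ on a metric space $X$ is cobounded if the translates of some bounded set cover $X$. A subset $C \subseteq X$ is convex if $z \in C$ whenever $x, y \in C$ and $d(x,z) + d(z,y) = d(x,y)$. The action is essential if no non-empty proper convex subset of $X$ is $G$-invariant. A group splits non-trivially as a direct product if it is isomorphic to $A \times B$ for some non-trivial groups $A$ and $B$. **Corollary C.** There exist a complete universal $\mathbb{R}$-tree $T$ with valence $2^{\aleph_0}$ and, writing $T_1 = T_2 = T$, a subgroup $G \leq \mathrm{Isom}(T_1) \times \mathrm{Isom}(T_2)$ such that the coordinatewise action of $G$ on the $\ell^1$-product $T_1 \times T_2$ (with metric $d((x_1,x_2),(y_1,y_2)) = d(x_1,y_1) + d(x_2,y_2)$) is by isometries, free and transitive, and: 1. $G$ is coboundedly irreducible: for every subgroup $H \leq G$ which splits non-trivially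 as a direct product, the induced action of $H$ on $T_1 \times T_2$ is not cobounded; 2. $G$ is essentially reducible: there is a subgroup $H \leq G$ which splits non-trivially as a direct product and whose induced action on $T_1 \times T_2$ is essential. -/

import Mathlib

universe u v

/-- `S` is the image of a geodesic from `x` to `y`, i.e. of an isometric embedding
`γ : [0, l] → X` with `γ 0 = x` and `γ l = y`. -/
def IsSegmentBetween {X : Type u} [MetricSpace X] (x y : X) (S : Set X) : Prop :=
  ∃ (l : ℝ) (γ : ℝ → X), 0 ≤ l ∧
    (∀ s ∈ Set.Icc (0 : ℝ) l, ∀ t ∈ Set.Icc (0 : ℝ) l, dist (γ s) (γ t) = |s - t|) ∧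
    γ 0 = x ∧ γ l = y ∧ S = γ '' Set.Icc (0 : ℝ) l

/-- `S` is a segment: the image of some geodesic. -/
def IsSegment {X : Type u} [MetricSpace X] (S : Set X) : Prop :=
  ∃ x y : X, IsSegmentBetween x y S

/-- `ℝ`-trees: geodesic metric spaces in which two segments meeting in exactly one point, an
endpoint of both, have a segment as their union, and in which the intersection of two segments
with a common endpoint is a segment. -/
structure IsRealTree (X : Type u) [MetricSpace X] : Prop where
  geodesic : ∀ x y : X, ∃ S : Set X, IsSegmentBetween x y S
  union : ∀ (x y z : X) (S S' : Set X), IsSegmentBetween x y S → IsSegmentBetween y z S' →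
    S ∩ S' = {y} → IsSegment (S ∪ S')
  inter : ∀ (x y z : X) (S S' : Set X), IsSegmentBetween x y S → IsSegmentBetween x z S' →
    IsSegment (S ∩ S')

/-- The set of geodesic-connected components of `X - {x}`: the quotient of `X - {x}` by the
equivalence relation generated by "`y` and `z` are joined by a segment that avoids `x`". -/
def Direction {X : Type u} [MetricSpace X] (x : X) : Type u :=
  Quot fun y z : {w : X // w ≠ x} => ∃ S : Set X, IsSegmentBetween (y : X) (z : X) S ∧ x ∉ S

/-- Every point of `X` has valence `κ`. -/
def HasValence (X : Type u) [MetricSpace X] (κ : Cardinal.{u}) : Prop :=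
  ∀ x : X, Cardinal.mk (Direction x) = κ

/-- `Isom X × Isom Y` acts coordinatewise on the `ℓ¹` product of `X` and `Y`. -/
noncomputable instance isomProdAction (X : Type u) (Y : Type v) [MetricSpace X] [MetricSpace Y] :
    MulAction ((X ≃ᵢ X) × (Y ≃ᵢ Y)) (WithLp 1 (X × Y)) where
  smul g p := WithLp.toLp 1 (g.1 p.fst, g.2 p.snd)
  one_smul _ := rfl
  mul_smul _ _ _ := rfl

/-- The group `G` is isomorphic to a direct product of two non-trivial groups. -/
def SplitsNontrivially (G : Type u) [Group G] : Prop :=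
  ∃ (A B : Type u) (_ : Group A) (_ : Group B),
    Nontrivial A ∧ Nontrivial B ∧ Nonempty (G ≃* A × B)

/-- An action is cobounded if the translates of some bounded set cover the space. -/
def IsCoboundedAction (G : Type u) (X : Type v) [Group G] [MetricSpace X] [MulAction G X] : Prop :=
  ∃ B : Set X, Bornology.IsBounded B ∧ ∀ x : X, ∃ g : G, ∃ b ∈ B, g • b = x

/-- Convexity in median spaces: `C` contains the interval
`{z | d(x,z) + d(z,y) = d(x,y)}` between any two of its points `x` and `y`. -/
def IsIntervalConvex {X : Type u} [MetricSpace X] (C : Set X) : Prop :=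
  ∀ x ∈ C, ∀ y ∈ C, ∀ z : X, dist x z + dist z y = dist x y → z ∈ C

/-- An action is essential if there is no proper non-empty invariant convex subspace. -/
def IsEssentialAction (G : Type u) (X : Type v) [Group G] [MetricSpace X] [MulAction G X] : Prop :=
  ∀ C : Set X, C.Nonempty → IsIntervalConvex C → (∀ g : G, ∀ x ∈ C, g • x ∈ C) → C = Set.univ

/-- Some subgroup that splits non-trivially as a direct product acts coboundedly. -/
def CoboundedlyReducible (G : Type u) (X : Type v) [Group G] [MetricSpace X] [MulAction G X] :
    Prop :=
  ∃ H : Subgroup G, SplitsNontrivially H ∧ IsCoboundedAction H X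

/-- Some subgroup that splits non-trivially as a direct product acts essentially. -/
def EssentiallyReducible (G : Type u) (X : Type v) [Group G] [MetricSpace X] [MulAction G X] :
    Prop :=
  ∃ H : Subgroup G, SplitsNontrivially H ∧ IsEssentialAction H X

/-!
Reduced paths in a normed space `V`, i.e. `1`-Lipschitz paths from `0` that never backtrack, form a
complete `ℝ`-tree when the distance of two paths is the length on which they do not agree. Reduced
concatenation turns this tree into a group acting on itself by isometries, and the endpoint
projects the tree onto `V`. An isometry that covers a translation of `V` and has a fixed point is
trivial: a path is determined by the end points of its initial subpaths.

Twist two copies of the tree by a homomorphism `θ` from `V` to its linear isometries: let the first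
component cover a translation by `v`, and let the second cover an affine isometry with linear part
`θ v`. The resulting group acts freely and transitively on the product. We take for `θ` a rotation
with irrational slope, so that its kernel is a hyperplane, at unbounded distance from points of `V`.

Suppose that commuting factors `A` and `B` together act coboundedly. In a tree an isometry without
fixed points has an axis, which commuting isometries preserve; hence whenever some element of `A`
has no fixed point in one of the trees, `B` acts trivially on that tree, and vice versa. So `A` or
`B` is trivial on the first tree. If it is `A`, then its non-trivial elements act freely on the
second tree, `B` is trivial there, and the translations of `V` covered by `A × B` lie in the kernel
of `θ`, contradicting coboundedness.

Elements of the kernel of `θ`, on the other hand, impose no condition on the second component. They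
provide a direct product of groups of isometries that is transitive on the second tree and whose
orbits in the first tree have every point lying between two of their members.
-/

/-! ### Geodesic `0`-hyperbolic spaces -/

section Betweenness

variable {X : Type u} [MetricSpace X] {x y z w : X}

/-- Metric betweenness: `y` lies on a geodesic from `x` to `z`. -/
def IsBetween (x y z : X) : Prop :=
  dist x y + dist y z = dist x z

/-- The interval `[x, y]` of points between `x` and `y`. In a tree it is the segment from `x`
to `y`. -/
def metricInterval (x y : X) : Set X :=
  {z | IsBetween x z y}

namespace IsBetween

theorem symm (h : IsBetween x y z) : IsBetween z y x := by
  unfold IsBetween at *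
  linarith [dist_comm z y, dist_comm y x, dist_comm z x]

theorem map (g : X ≃ᵢ X) (h : IsBetween x y z) : IsBetween (g x) (g y) (g z) := by
  simpa [IsBetween, g.dist_eq] using h

theorem left_of_right (h : IsBetween x y z) (h' : IsBetween y w z) : IsBetween x w z := by
  unfold IsBetween at *
  linarith [dist_triangle x w z, dist_triangle x y w]

theorem right_of_left (h : IsBetween x y z) (h' : IsBetween x w y) : IsBetween x w z :=
  (h.symm.left_of_right h'.symm).symm

end IsBetween

theorem image_Icc_eq_metricInterval {γ : ℝ → X}
    (huniq : ∀ z w, IsBetween x z y → IsBetween x w y → dist x z = dist x w → z = w)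
    (hγ : ∀ s ∈ Set.Icc 0 (dist x y), dist x (γ s) = s ∧ IsBetween x (γ s) y) :
    γ '' Set.Icc 0 (dist x y) = metricInterval x y := by
  refine Set.Subset.antisymm (Set.image_subset_iff.2 fun s hs => (hγ s hs).2) fun z hz => ?_
  have hzxy : dist x z + dist z y = dist x y := hz
  have hs : dist x z ∈ Set.Icc 0 (dist x y) :=
    ⟨dist_nonneg, by linarith [dist_nonneg (x := z) (y := y)]⟩
  exact ⟨_, hs, huniq _ _ (hγ _ hs).2 hz (hγ _ hs).1⟩

end Betweenness

/-- Geodesic `0`-hyperbolic spaces: Gromov's four point inequality holds with `δ = 0` and any two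
points are joined by points at all intermediate distances. These are the `ℝ`-trees, described
without mentioning segments. -/
structure IsZeroHyperbolic (X : Type u) [MetricSpace X] : Prop where
  four_point : ∀ x y z w : X,
    dist x y + dist z w ≤ max (dist x z + dist y w) (dist x w + dist y z)
  exists_dist_eq : ∀ (x y : X), ∀ s ∈ Set.Icc 0 (dist x y),
    ∃ z, dist x z = s ∧ dist z y = dist x y - s

namespace IsZeroHyperbolic

variable {X : Type u} [MetricSpace X] {x y z w : X}

variable (hX : IsZeroHyperbolic X)

include hX

theorem isBetween_or (h : IsBetween x y z) (w : X) : IsBetween w y x ∨ IsBetween w y z := by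
  have h4 := hX.four_point w y x z
  unfold IsBetween at *
  rcases le_max_iff.1 h4 with h5 | h5
  · left; linarith [dist_triangle w y x, dist_comm x y]
  · right; linarith [dist_triangle w y z, dist_comm x y]

theorem dist_of_isBetween (hy : IsBetween x y z) (hw : IsBetween x w z) :
    dist y w = |dist x y - dist x w| := by
  have hyw := dist_nonneg (x := y) (y := w)
  rcases hX.isBetween_or hy w with h | h <;> unfold IsBetween at *
  · rw [abs_sub_comm, abs_of_nonneg] <;> linarith [dist_comm w y, dist_comm y x, dist_comm w x]
  · rw [abs_of_nonneg] <;> linarith [dist_comm w y]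

theorem eq_of_isBetween (hy : IsBetween x y z) (hw : IsBetween x w z)
    (h : dist x y = dist x w) : y = w := by
  rw [← dist_eq_zero, hX.dist_of_isBetween hy hw, h, sub_self, abs_zero]

theorem isBetween_trans_of_ne (h : IsBetween x y z) (h' : IsBetween y z w) (hyz : y ≠ z) :
    IsBetween x z w := by
  refine (hX.isBetween_or h' x).resolve_left fun hxzy => hyz (dist_le_zero.1 ?_)
  unfold IsBetween at *
  linarith [dist_comm y z]

theorem isBetween_of_dist_lt (h : IsBetween x y z) (hlt : dist x w < dist x y) :
    IsBetween w y z := by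
  refine (hX.isBetween_or h w).resolve_left fun hwyx => ?_
  unfold IsBetween at hwyx
  linarith [dist_comm x y, dist_comm x w, dist_nonneg (x := w) (y := y)]

theorem exists_midpoint (x y : X) :
    ∃ m, IsBetween x m y ∧ dist x m = dist x y / 2 ∧ dist m y = dist x y / 2 := by
  have hxy := dist_nonneg (x := x) (y := y)
  obtain ⟨m, hxm, hmy⟩ := hX.exists_dist_eq x y (dist x y / 2) ⟨by linarith, by linarith⟩
  exact ⟨m, by unfold IsBetween; linarith, hxm, by linarith⟩

theorem exists_median (x y z : X) :
    ∃ m, IsBetween x m y ∧ IsBetween x m z ∧ IsBetween y m z := by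
  -- `m` is the point of `[x, y]` whose distance from `x` is the Gromov product of `y` and `z`.
  obtain ⟨m, hxm, hmy⟩ := hX.exists_dist_eq x y ((dist x y + dist x z - dist y z) / 2)
    ⟨by linarith [dist_triangle y x z, dist_comm x y], by linarith [dist_triangle x y z]⟩
  have hmz : dist m z ≤ (dist x z + dist y z - dist x y) / 2 := by
    rcases le_max_iff.1 (hX.four_point m z x y) with h | h <;>
      linarith [dist_comm m x, dist_comm z y, dist_comm z x]
  refine ⟨m, ?_, ?_, ?_⟩ <;> unfold IsBetween <;>
    linarith [dist_triangle x m z, dist_triangle y m z, dist_comm y m]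

/-! ### Segments and directions -/

theorem isSegmentBetween_metricInterval (x y : X) :
    IsSegmentBetween x y (metricInterval x y) := by
  have hex : ∀ s : ℝ, ∃ z : X,
      s ∈ Set.Icc 0 (dist x y) → dist x z = s ∧ IsBetween x z y := fun s => by
    by_cases hs : s ∈ Set.Icc 0 (dist x y)
    · obtain ⟨z, hxz, hzy⟩ := hX.exists_dist_eq x y s hs
      exact ⟨z, fun _ => ⟨hxz, by unfold IsBetween; linarith⟩⟩
    · exact ⟨x, fun h => absurd h hs⟩
  choose γ hγ using hex
  obtain ⟨hγ0, -⟩ := hγ 0 ⟨le_rfl, dist_nonneg⟩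
  obtain ⟨hγl, hγl'⟩ := hγ (dist x y) ⟨dist_nonneg, le_rfl⟩
  refine ⟨dist x y, γ, dist_nonneg, fun s hs t ht => ?_, (dist_eq_zero.1 hγ0).symm, ?_,
    (image_Icc_eq_metricInterval (fun _ _ => hX.eq_of_isBetween) hγ).symm⟩
  · rw [hX.dist_of_isBetween (hγ s hs).2 (hγ t ht).2, (hγ s hs).1, (hγ t ht).1]
  · unfold IsBetween at hγl'
    exact dist_eq_zero.1 (by linarith)

theorem eq_metricInterval {S : Set X} (hS : IsSegmentBetween x y S) : S = metricInterval x y := by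
  obtain ⟨l, γ, hl, hγ, rfl, rfl, rfl⟩ := hS
  have h0 : (0 : ℝ) ∈ Set.Icc 0 l := ⟨le_rfl, hl⟩
  have h1 : l ∈ Set.Icc 0 l := ⟨hl, le_rfl⟩
  have hdist_left : ∀ s ∈ Set.Icc 0 l, dist (γ 0) (γ s) = s := fun s hs => by
    rw [hγ 0 h0 s hs, zero_sub, abs_neg, abs_of_nonneg hs.1]
  have hdist_right : ∀ s ∈ Set.Icc 0 l, dist (γ s) (γ l) = l - s := fun s hs => by
    rw [hγ s hs l h1, abs_sub_comm, abs_of_nonneg (sub_nonneg.2 hs.2)]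
  conv_lhs => rw [← hdist_left l h1]
  refine image_Icc_eq_metricInterval (fun _ _ => hX.eq_of_isBetween) fun s hs => ?_
  rw [hdist_left l h1] at hs
  refine ⟨hdist_left s hs, ?_⟩
  rw [IsBetween, hdist_left s hs, hdist_right s hs, hdist_left l h1, add_sub_cancel]

theorem metricInterval_union (h : IsBetween x y z) :
    metricInterval x y ∪ metricInterval y z = metricInterval x z := by
  ext w
  refine ⟨fun hw => hw.elim h.right_of_left h.left_of_right, fun hw => ?_⟩
  change IsBetween x w z at hw
  rcases hX.isBetween_or h w with hwyx | hwyz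
  · right
    unfold metricInterval IsBetween at *
    exact show _ = _ by linarith [dist_comm w y, dist_comm y x, dist_comm w x]
  · left
    unfold metricInterval IsBetween at *
    exact show _ = _ by linarith [dist_comm w y]

theorem metricInterval_inter {m : X} (hxy : IsBetween x m y) (hxz : IsBetween x m z)
    (hyz : IsBetween y m z) :
    metricInterval x y ∩ metricInterval x z = metricInterval x m := by
  have key : ∀ {v w : X}, IsBetween x m v → IsBetween x w v → IsBetween w m v →
      IsBetween x w m := fun hm hw hwm => by
    unfold IsBetween at *
    linarith
  ext w
  refine ⟨fun ⟨hwy, hwz⟩ => ?_, fun hw => ⟨hxy.right_of_left hw, hxz.right_of_left hw⟩⟩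
  exact (hX.isBetween_or hyz w).elim (key hxy hwy) (key hxz hwz)

theorem isRealTree : IsRealTree X where
  geodesic x y := ⟨_, hX.isSegmentBetween_metricInterval x y⟩
  union x y z S S' hS hS' hSS' := by
    rw [hX.eq_metricInterval hS, hX.eq_metricInterval hS'] at *
    obtain ⟨m, hyx, hyz, hxz⟩ := hX.exists_median y x z
    have hm : m ∈ ({y} : Set X) := hSS' ▸ ⟨hyx.symm, hyz⟩
    rw [Set.mem_singleton_iff.1 hm] at hxz
    exact ⟨x, z, hX.metricInterval_union hxz ▸ hX.isSegmentBetween_metricInterval x z⟩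
  inter x y z S S' hS hS' := by
    rw [hX.eq_metricInterval hS, hX.eq_metricInterval hS']
    obtain ⟨m, hxy, hxz, hyz⟩ := hX.exists_median x y z
    exact ⟨x, m, hX.metricInterval_inter hxy hxz hyz ▸ hX.isSegmentBetween_metricInterval x m⟩

theorem not_isBetween_equivalence (x : X) :
    Equivalence fun y z : {w : X // w ≠ x} => ¬ IsBetween (y : X) x z where
  refl y h := by
    have hy : 0 < dist (y : X) x := dist_pos.2 y.2
    rw [IsBetween, dist_self] at h
    linarith [dist_comm x (y : X)]
  symm h h' := h h'.symm
  trans {y z w} hyz hzw hyw := (hX.isBetween_or hyw z).elim (fun h => hyz h.symm) hzw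

theorem mk_le_mk_direction {ι : Type u} (f : ι → X) (hne : ∀ i, f i ≠ x)
    (hf : Pairwise fun i j => IsBetween (f i) x (f j)) :
    Cardinal.mk ι ≤ Cardinal.mk (Direction x) := by
  let side : Direction x → Quotient ⟨_, hX.not_isBetween_equivalence x⟩ :=
    Quot.map id fun y z ⟨S, hS, hxS⟩ h => hxS (hX.eq_metricInterval hS ▸ h)
  refine Cardinal.mk_le_of_injective (f := fun i => Quot.mk _ ⟨f i, hne i⟩) fun i j hij => ?_
  by_contra hne
  exact Quotient.exact (congrArg side hij) (hf hne)

end IsZeroHyperbolic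

/-! ### Commuting isometries of a tree -/

/-- The axis of an isometry `p`: the points `z` for which `z, p z, p (p z)` are aligned. When `p`
is an isometry of a tree without fixed points, this is the line along which `p` translates. -/
def axis {X : Type u} [MetricSpace X] (p : X ≃ᵢ X) : Set X :=
  {z | IsBetween z (p z) (p (p z))}

/-- Around every point there are three legs of arbitrary length, any two of which meet only in that
point. -/
def HasUnboundedTripods (X : Type u) [MetricSpace X] : Prop :=
  ∀ (o : X) (r : ℝ), ∃ f : Fin 3 → X,
    (∀ i, r < dist o (f i)) ∧ Pairwise fun i j => IsBetween (f i) o (f j)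

theorem abs_add_abs_of_abs_eq {a b : ℝ} (h : |a| = |b|) (hab : a + b ≠ 0) :
    |a| + |b| = |a + b| := by
  rcases abs_eq_abs.1 h with rfl | rfl
  · rw [← two_mul, ← two_mul, abs_mul, abs_two]
  · exact absurd (neg_add_cancel b) hab

section Commute

variable {X : Type u} [MetricSpace X] {p q : X ≃ᵢ X} {x z : X}

theorem apply_comm_of_commute (h : Commute p q) (x : X) : p (q x) = q (p x) :=
  DFunLike.congr_fun h.eq x

theorem apply_mem_axis_of_commute (h : Commute p q) (hz : z ∈ axis p) : q z ∈ axis p := by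
  change IsBetween _ _ _
  rw [apply_comm_of_commute h, apply_comm_of_commute h]
  exact IsBetween.map q hz

end Commute

namespace IsZeroHyperbolic

variable {X : Type u} [MetricSpace X] {p q : X ≃ᵢ X} {x y z : X} (hX : IsZeroHyperbolic X)

include hX

theorem exists_fixed_of_apply_apply_eq (h : q (q x) = x) : ∃ m, q m = m := by
  obtain ⟨m, hm, hxm, hmx⟩ := hX.exists_midpoint x (q x)
  have hqm : IsBetween x (q m) (q x) := by simpa only [h] using (hm.map q).symm
  refine ⟨m, hX.eq_of_isBetween hqm hm ?_⟩
  calc dist x (q m) = dist (q (q x)) (q m) := by rw [h]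
    _ = dist x m := by rw [q.dist_eq, dist_comm, hmx, hxm]

theorem axis_nonempty (hp : ∀ x, p x ≠ x) (x : X) : (axis p).Nonempty := by
  obtain ⟨m, hm, hxm, hmx⟩ := hX.exists_midpoint x (p x)
  have hpm : dist m (p m) ≠ 0 := dist_ne_zero.2 (hp m).symm
  have hstep : IsBetween m (p m) (p (p x)) := by
    refine (hX.isBetween_or (hm.map p) m).resolve_left fun h => hpm ?_
    rw [IsBetween, p.dist_eq, dist_comm m x] at h
    linarith
  refine ⟨m, ((hX.isBetween_or hstep (p (p m))).resolve_right fun h => hpm ?_).symm⟩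
  simp only [IsBetween, p.dist_eq, dist_comm (p m) m] at h
  linarith [dist_comm x m]

theorem isBetween_pow_succ (hp : p z ≠ z) (hz : z ∈ axis p) (n : ℕ) :
    IsBetween z ((p ^ n) z) ((p ^ (n + 1)) z) := by
  induction n with
  | zero => simp [IsBetween]
  | succ n ih =>
    have hstep : IsBetween ((p ^ n) z) ((p ^ (n + 1)) z) ((p ^ (n + 2)) z) := by
      rw [pow_succ _ (n + 1), pow_succ]
      exact IsBetween.map (p ^ n) hz
    refine hX.isBetween_trans_of_ne ih hstep fun h => hp ?_
    rw [pow_succ] at h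
    exact ((p ^ n).injective h).symm

theorem dist_pow_apply (hp : p z ≠ z) (hz : z ∈ axis p) (n : ℕ) :
    dist z ((p ^ n) z) = n * dist z (p z) := by
  induction n with
  | zero => simp
  | succ n ih =>
    have hlast : dist ((p ^ n) z) ((p ^ (n + 1)) z) = dist z (p z) := (p ^ n).dist_eq z (p z)
    rw [← hX.isBetween_pow_succ hp hz n, ih, hlast]
    push_cast
    ring

theorem eventually_isBetween_pow (hp : p z ≠ z) (hz : z ∈ axis p) (x : X) :
    ∀ᶠ n : ℕ in Filter.atTop, IsBetween ((p ^ n)⁻¹ x) z ((p ^ n) x) := by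
  have hlarge : ∀ᶠ n : ℕ in Filter.atTop, dist z x < n * dist z (p z) :=
    (tendsto_natCast_atTop_atTop.atTop_mul_const (dist_pos.2 hp.symm)).eventually_gt_atTop _
  filter_upwards [hlarge] with n hn
  have hcancel : ∀ w, (p ^ n) ((p ^ n)⁻¹ w) = w := (p ^ n).apply_symm_apply
  have hpow : dist ((p ^ n)⁻¹ z) z = n * dist z (p z) := by
    rw [← (p ^ n).dist_eq, hcancel, hX.dist_pow_apply hp hz]
  have hlong : dist ((p ^ n)⁻¹ z) ((p ^ n) z) = (n + n) * dist z (p z) := by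
    rw [← (p ^ n).dist_eq, hcancel, ← Nat.cast_add, ← hX.dist_pow_apply hp hz, pow_add]
    rfl
  have hmid : IsBetween ((p ^ n)⁻¹ z) z ((p ^ n) z) := by
    unfold IsBetween
    rw [hpow, hlong, hX.dist_pow_apply hp hz, add_mul]
  have hleft : IsBetween ((p ^ n)⁻¹ x) z ((p ^ n) z) := by
    refine hX.isBetween_of_dist_lt hmid ?_
    rwa [hpow, ← (p ^ n).dist_eq, hcancel, hcancel]
  refine (hX.isBetween_of_dist_lt hleft.symm ?_).symm
  rwa [(p ^ n).dist_eq, dist_comm _ z, hX.dist_pow_apply hp hz]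

theorem apply_eq_self_of_mem_axis (hp : p z ≠ z) (hz : z ∈ axis p) (hcomm : Commute p q)
    (hx : q x = x) : q z = z := by
  obtain ⟨n, hn⟩ := (hX.eventually_isBetween_pow hp hz x).exists
  have hright : q ((p ^ n) x) = (p ^ n) x := by
    rw [← apply_comm_of_commute (hcomm.pow_left n), hx]
  have hleft : q ((p ^ n)⁻¹ x) = (p ^ n)⁻¹ x := by
    rw [← apply_comm_of_commute (hcomm.pow_left n).inv_left, hx]
  have hqn : IsBetween ((p ^ n)⁻¹ x) (q z) ((p ^ n) x) := by
    simpa only [hleft, hright] using hn.map q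
  refine hX.eq_of_isBetween hqn hn ?_
  conv_lhs => rw [← hleft, q.dist_eq]

theorem axis_subset_axis (hp : ∀ x, p x ≠ x) (hq : ∀ x, q x ≠ x) (hcomm : Commute p q) :
    axis p ⊆ axis q := by
  intro z hz
  have hqz : q z ∈ axis p := apply_mem_axis_of_commute hcomm hz
  have hqqz : q (q z) ∈ axis p := apply_mem_axis_of_commute hcomm hqz
  -- `z`, `q z` and `q (q z)` all lie on one segment, and `q (q z) = z` is excluded.
  obtain ⟨n, h₀, h₁, h₂⟩ := ((hX.eventually_isBetween_pow (hp _) hz z).and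
    ((hX.eventually_isBetween_pow (hp _) hqz z).and
      (hX.eventually_isBetween_pow (hp _) hqqz z))).exists
  have hz_ne : dist z (q (q z)) ≠ 0 := fun h =>
    (hX.exists_fixed_of_apply_apply_eq (dist_eq_zero.1 h).symm).elim hq
  have h₀₁ := hX.dist_of_isBetween h₀ h₁
  have h₁₂ := hX.dist_of_isBetween h₁ h₂
  have h₀₂ := hX.dist_of_isBetween h₀ h₂
  change dist z (q z) + dist (q z) (q (q z)) = dist z (q (q z))
  have hstep := q.dist_eq z (q z)
  rw [h₀₁, h₁₂] at hstep
  rw [h₀₁, h₁₂, h₀₂, abs_add_abs_of_abs_eq hstep.symm, sub_add_sub_cancel]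
  rwa [sub_add_sub_cancel, ← abs_ne_zero, ← h₀₂]

theorem dist_apply_le_of_mem_axis (hp : ∀ x, p x ≠ x) {w : X} (hz : z ∈ axis p) (hw : w ∈ axis p) :
    dist z (p z) ≤ dist w (p w) := by
  by_contra! hlt
  obtain ⟨n, hn⟩ := exists_nat_gt (2 * dist z w / (dist z (p z) - dist w (p w)))
  rw [div_lt_iff₀ (sub_pos.2 hlt)] at hn
  have h := dist_triangle4 z w ((p ^ n) w) ((p ^ n) z)
  rw [(p ^ n).dist_eq, dist_comm w z, hX.dist_pow_apply (hp z) hz,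
    hX.dist_pow_apply (hp w) hw] at h
  linarith

theorem eq_one_of_dist_apply_le (hT : HasUnboundedTripods X) {M : ℝ}
    (hp : ∀ y, dist y (p y) ≤ M) : p = 1 := by
  ext o
  by_contra hpo
  obtain ⟨f, hfar, hf⟩ := hT o M
  obtain ⟨i, hi, hi'⟩ : ∃ i, IsBetween (p o) o (f i) ∧ IsBetween (p⁻¹ o) o (f i) := by
    by_contra! h
    have h₀₁ := hX.isBetween_or (hf (show (0 : Fin 3) ≠ 1 by decide))
    have h₀₂ := hX.isBetween_or (hf (show (0 : Fin 3) ≠ 2 by decide))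
    have h₁₂ := hX.isBetween_or (hf (show (1 : Fin 3) ≠ 2 by decide))
    have := h 0
    have := h 1
    have := h 2
    grind
  have hout : IsBetween o (p o) (p (f i)) := by
    simpa only [show p (p⁻¹ o) = o from p.apply_symm_apply o] using hi'.map p
  have hpath := hX.isBetween_trans_of_ne hi.symm hout (Ne.symm hpo)
  unfold IsBetween at hi hpath
  linarith [hp (f i), hfar i, dist_comm o (f i), dist_comm (p o) (f i), dist_comm o (p o),
    dist_nonneg (x := p o) (y := o), dist_nonneg (x := p o) (y := p (f i))]

end IsZeroHyperbolic

section CoboundedFamilies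

variable {X : Type u} [MetricSpace X] {ι κ : Type*} {p : ι → X ≃ᵢ X} {q : κ → X ≃ᵢ X} {o : X}
  {R : ℝ} {i₀ : ι} {j₀ : κ}

theorem dist_apply_le_of_orbit (hR : ∀ y, ∃ i j, dist y (p i (q j o)) ≤ R) {g : X ≃ᵢ X} {z : X}
    {C : ℝ} (hg : ∀ i j, dist (p i (q j z)) (g (p i (q j z))) ≤ C) (y : X) :
    dist y (g y) ≤ 2 * (R + dist o z) + C := by
  obtain ⟨i, j, hy⟩ := hR y
  have hyz : dist y (p i (q j z)) ≤ R + dist o z :=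
    (dist_triangle _ (p i (q j o)) _).trans (by rw [(p i).dist_eq, (q j).dist_eq]; gcongr)
  have h := dist_triangle4 y (p i (q j z)) (g (p i (q j z))) (g y)
  rw [g.dist_eq, dist_comm (p i (q j z)) y] at h
  linarith [hg i j]

namespace IsZeroHyperbolic

variable (hX : IsZeroHyperbolic X) (hcomm : ∀ i j, Commute (p i) (q j))
  (hR : ∀ y, ∃ i j, dist y (p i (q j o)) ≤ R)

include hX hcomm hR

theorem exists_dist_apply_le_of_translations (hp : ∀ x, p i₀ x ≠ x) (hq : ∀ x, q j₀ x ≠ x) :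
    ∃ M, ∀ y, dist y (p i₀ y) ≤ M := by
  obtain ⟨z, hz⟩ := hX.axis_nonempty hp o
  have hpq : axis (p i₀) ⊆ axis (q j₀) := hX.axis_subset_axis hp hq (hcomm i₀ j₀)
  have hqp : axis (q j₀) ⊆ axis (p i₀) := hX.axis_subset_axis hq hp (hcomm i₀ j₀).symm
  -- The `q j` preserve the axis of `p i₀`, the `p i` that of `q j₀`, and these axes coincide.
  have horbit : ∀ i j, p i (q j z) ∈ axis (p i₀) := fun i j =>
    hqp (apply_mem_axis_of_commute (hcomm i j₀).symm
      (hpq (apply_mem_axis_of_commute (hcomm i₀ j) hz)))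
  exact ⟨_, dist_apply_le_of_orbit hR fun i j => hX.dist_apply_le_of_mem_axis hp (horbit i j) hz⟩

theorem exists_dist_apply_le_of_fixed (hp : ∀ x, p i₀ x ≠ x) (hq : ∀ j, ∃ x, q j x = x) (j : κ) :
    ∃ M, ∀ y, dist y (q j y) ≤ M := by
  obtain ⟨z, hz⟩ := hX.axis_nonempty hp o
  have hfix : ∀ j, q j z = z := fun j =>
    (hq j).elim fun x hx => hX.apply_eq_self_of_mem_axis (hp z) hz (hcomm i₀ j) hx
  refine ⟨_, dist_apply_le_of_orbit hR (z := z) (C := 0) fun i j' => ?_⟩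
  rw [← apply_comm_of_commute (hcomm i j), hfix j', hfix j, dist_self]

theorem eq_one_of_cobounded (hT : HasUnboundedTripods X) (hp : ∀ x, p i₀ x ≠ x) (j : κ) :
    q j = 1 := by
  by_cases hq : ∃ j₀, ∀ x, q j₀ x ≠ x
  · obtain ⟨j₀, hj₀⟩ := hq
    obtain ⟨M, hM⟩ := hX.exists_dist_apply_le_of_translations hcomm hR hp hj₀
    exact absurd (DFunLike.congr_fun (hX.eq_one_of_dist_apply_le hT hM) o) (hp o)
  · push Not at hq
    obtain ⟨M, hM⟩ := hX.exists_dist_apply_le_of_fixed hcomm hR hp hq j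
    exact hX.eq_one_of_dist_apply_le hT hM

end IsZeroHyperbolic

end CoboundedFamilies

/-! ### Coordinatewise actions on `ℓ¹` products -/

section ProdAction

variable {X : Type u} {Y : Type v} [MetricSpace X] [MetricSpace Y]

theorem dist_prod_one (x y : WithLp 1 (X × Y)) :
    dist x y = dist x.fst y.fst + dist x.snd y.snd := by
  rw [WithLp.prod_dist_eq_add (by rw [ENNReal.toReal_one]; exact one_pos)]
  simp only [ENNReal.toReal_one, Real.rpow_one, one_div_one]

instance isIsometricSMul_isomProdAction (G : Subgroup ((X ≃ᵢ X) × (Y ≃ᵢ Y))) :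
    IsIsometricSMul G (WithLp 1 (X × Y)) :=
  ⟨fun g => Isometry.of_dist_eq fun x y => by
    rw [dist_prod_one, dist_prod_one]
    exact congrArg₂ (· + ·) (g.1.1.dist_eq _ _) (g.1.2.dist_eq _ _)⟩

theorem IsCoboundedAction.exists_dist_le {G : Subgroup ((X ≃ᵢ X) × (Y ≃ᵢ Y))} {H : Subgroup G}
    (hH : IsCoboundedAction H (WithLp 1 (X × Y))) (o : X) (o' : Y) :
    ∃ R, ∀ x y, ∃ h : H, dist x (h.1.1.1 o) ≤ R ∧ dist y (h.1.1.2 o') ≤ R := by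
  obtain ⟨B, hB, hcov⟩ := hH
  obtain ⟨R, hR⟩ := hB.subset_closedBall (WithLp.toLp 1 (o, o'))
  refine ⟨R, fun x y => ?_⟩
  obtain ⟨h, b, hb, hxy⟩ := hcov (WithLp.toLp 1 (x, y))
  have hx : h.1.1.1 b.fst = x := congrArg WithLp.fst hxy
  have hy : h.1.1.2 b.snd = y := congrArg WithLp.snd hxy
  have hbR : dist b.fst o + dist b.snd o' ≤ R := (dist_prod_one b _).symm.trans_le (hR hb)
  refine ⟨h, ?_⟩
  rw [← hx, ← hy, IsometryEquiv.dist_eq, IsometryEquiv.dist_eq]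
  exact ⟨le_of_add_le_of_nonneg_left hbR dist_nonneg,
    le_of_add_le_of_nonneg_right hbR dist_nonneg⟩

end ProdAction

/-- The largest direct product `A × B` of subgroups of the two factors that is contained in `G`. -/
def rectangularPart {M N : Type*} [Group M] [Group N] (G : Subgroup (M × N)) : Subgroup (M × N) :=
  (G.comap (MonoidHom.inl M N)).prod (G.comap (MonoidHom.inr M N))

theorem rectangularPart_le {M N : Type*} [Group M] [Group N] (G : Subgroup (M × N)) :
    rectangularPart G ≤ G := by
  rintro ⟨m, n⟩ ⟨hm, hn⟩
  rw [← Prod.fst_mul_snd (m, n)]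
  exact mul_mem hm hn

/-! ### Reduced paths -/

open Filter Topology Cardinal

/-- A `1`-Lipschitz path `[0, len] → V` starting at `0`, extended to `ℝ` by constants, which does
not backtrack at any interior time. Reduced paths are the points of the universal tree over `V`. -/
@[ext]
structure ReducedPath (V : Type*) [NormedAddCommGroup V] where
  toFun : ℝ → V
  len : ℝ
  len_nonneg : 0 ≤ len
  lipschitz : LipschitzWith 1 toFun
  of_nonpos : ∀ t ≤ 0, toFun t = 0
  of_len_le : ∀ t, len ≤ t → toFun t = toFun len
  reduced : ∀ t ∈ Set.Ioo 0 len, ∃ᶠ s in 𝓝[>] (0 : ℝ), toFun (t + s) ≠ toFun (t - s)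

namespace ReducedPath

variable {V : Type*} [NormedAddCommGroup V]

instance : CoeFun (ReducedPath V) fun _ => ℝ → V := ⟨toFun⟩

theorem norm_apply_sub_le (F : ReducedPath V) (s t : ℝ) : ‖F s - F t‖ ≤ |s - t| := by
  simpa [dist_eq_norm] using F.lipschitz.dist_le_mul s t

theorem apply_min_len (F : ReducedPath V) (t : ℝ) : F (min t F.len) = F t := by
  rcases le_total t F.len with h | h
  · rw [min_eq_left h]
  · rw [min_eq_right h, F.of_len_le t h]

theorem eq_of_eqOn {F G : ReducedPath V} (hlen : F.len = G.len)
    (h : Set.EqOn F G (Set.Icc 0 F.len)) : F = G := by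
  refine ReducedPath.ext (funext fun t => ?_) hlen
  rcases le_total t 0 with h0 | h0
  · rw [F.of_nonpos t h0, G.of_nonpos t h0]
  rcases le_total t F.len with h1 | h1
  · exact h ⟨h0, h1⟩
  · rw [F.of_len_le t h1, G.of_len_le t (hlen ▸ h1), ← hlen, h ⟨F.len_nonneg, le_rfl⟩]

/-- The end point of a path; it projects the tree of reduced paths onto `V`. -/
def endpoint (F : ReducedPath V) : V := F F.len

/-- The length of the longest common initial subpath of `F` and `G`, i.e. their Gromov product
based at the constant path. -/
noncomputable def commonLength (F G : ReducedPath V) : ℝ :=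
  sSup {s | s ≤ F.len ∧ s ≤ G.len ∧ Set.EqOn F G (Set.Iic s)}

section CommonLength

variable {F G : ReducedPath V} {s t : ℝ}

theorem bddAbove_commonLength :
    BddAbove {s | s ≤ F.len ∧ s ≤ G.len ∧ Set.EqOn F G (Set.Iic s)} :=
  ⟨F.len, fun _ h => h.1⟩

theorem le_commonLength (hF : s ≤ F.len) (hG : s ≤ G.len) (h : ∀ u ∈ Set.Icc 0 s, F u = G u) :
    s ≤ commonLength F G := by
  refine le_csSup bddAbove_commonLength ⟨hF, hG, fun u hu => ?_⟩
  rcases le_total u 0 with h0 | h0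
  · rw [F.of_nonpos u h0, G.of_nonpos u h0]
  · exact h u ⟨h0, hu⟩

variable (F G) in
theorem commonLength_nonneg : 0 ≤ commonLength F G :=
  le_commonLength F.len_nonneg G.len_nonneg fun u hu => by
    rw [F.of_nonpos u hu.2, G.of_nonpos u hu.2]

theorem nonempty_commonLength :
    {s | s ≤ F.len ∧ s ≤ G.len ∧ Set.EqOn F G (Set.Iic s)}.Nonempty :=
  ⟨0, F.len_nonneg, G.len_nonneg, fun u hu => by rw [F.of_nonpos u hu, G.of_nonpos u hu]⟩

variable (F G) in
theorem commonLength_le_left : commonLength F G ≤ F.len :=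
  csSup_le nonempty_commonLength fun _ h => h.1

variable (F G) in
theorem commonLength_le_right : commonLength F G ≤ G.len :=
  csSup_le nonempty_commonLength fun _ h => h.2.1

theorem apply_eq_of_le_commonLength (ht : t ≤ commonLength F G) : F t = G t := by
  have hlt : Set.Iio (commonLength F G) ⊆ {u | F u = G u} := fun v hv => by
    obtain ⟨s, hs, hvs⟩ := exists_lt_of_lt_csSup nonempty_commonLength hv
    exact hs.2.2 hvs.le
  have hle := closure_minimal hlt (isClosed_eq F.lipschitz.continuous G.lipschitz.continuous)
  rw [closure_Iio] at hle
  exact hle ht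

theorem commonLength_eq (hF : s ≤ F.len) (hG : s ≤ G.len) (h : ∀ u ∈ Set.Icc 0 s, F u = G u)
    (hne : s < F.len → s < G.len → ∃ᶠ ε in 𝓝[>] 0, F (s + ε) ≠ G (s + ε)) :
    commonLength F G = s := by
  refine le_antisymm (not_lt.1 fun hlt => ?_) (le_commonLength hF hG h)
  refine hne (hlt.trans_le (commonLength_le_left F G)) (hlt.trans_le (commonLength_le_right F G)) ?_
  filter_upwards [Ioo_mem_nhdsGT (sub_pos.2 hlt)] with ε hε
  exact not_not.2 (apply_eq_of_le_commonLength (by linarith [hε.2]))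

theorem frequently_ne_of_commonLength_lt (hF : commonLength F G < F.len)
    (hG : commonLength F G < G.len) :
    ∃ᶠ ε in 𝓝[>] 0, F (commonLength F G + ε) ≠ G (commonLength F G + ε) := by
  intro h
  obtain ⟨b, hb, heq⟩ := mem_nhdsGT_iff_exists_Ioo_subset.1 h
  obtain ⟨s, hs, hsb⟩ :=
    exists_between (lt_min (lt_add_of_pos_right (commonLength F G) hb) (lt_min hF hG))
  obtain ⟨hsb, hsF, hsG⟩ := by simpa only [lt_min_iff] using hsb
  refine hs.not_ge (le_commonLength hsF.le hsG.le fun u hu => ?_)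
  rcases le_or_gt u (commonLength F G) with h0 | h0
  · exact apply_eq_of_le_commonLength h0
  · rw [← add_sub_cancel (commonLength F G) u]
    exact not_not.1 (heq ⟨sub_pos.2 h0, by linarith [hu.2]⟩)

variable (F G)

theorem commonLength_comm : commonLength F G = commonLength G F := by
  have key : ∀ F G : ReducedPath V, commonLength F G ≤ commonLength G F := fun F G =>
    le_commonLength (commonLength_le_right F G) (commonLength_le_left F G) fun _ hu =>
      (apply_eq_of_le_commonLength hu.2).symm
  exact le_antisymm (key F G) (key G F)

theorem commonLength_self : commonLength F F = F.len :=
  (commonLength_le_left F F).antisymm (le_commonLength le_rfl le_rfl fun _ _ => rfl)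

theorem min_commonLength_le (H : ReducedPath V) :
    min (commonLength F G) (commonLength G H) ≤ commonLength F H :=
  le_commonLength ((min_le_left _ _).trans (commonLength_le_left F G))
    ((min_le_right _ _).trans (commonLength_le_right G H)) fun _ hu =>
      (apply_eq_of_le_commonLength (hu.2.trans (min_le_left _ _))).trans
        (apply_eq_of_le_commonLength (hu.2.trans (min_le_right _ _)))

end CommonLength

noncomputable instance : MetricSpace (ReducedPath V) where
  dist F G := F.len + G.len - 2 * commonLength F G
  dist_self F := by rw [commonLength_self]; ring
  dist_comm F G := by rw [commonLength_comm]; ring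
  dist_triangle F G H := by
    have hFG := commonLength_le_right F G
    have hGH := commonLength_le_left G H
    rcases min_le_iff.1 (min_commonLength_le F G H) with h | h <;> linarith
  eq_of_dist_eq_zero {F G} h := by
    have hF := commonLength_le_left F G
    have hG := commonLength_le_right F G
    exact eq_of_eqOn (by linarith) fun t ht => apply_eq_of_le_commonLength (by linarith [ht.2])

theorem dist_def (F G : ReducedPath V) : dist F G = F.len + G.len - 2 * commonLength F G := rfl

theorem apply_eq_of_le_len_sub_dist {F G : ReducedPath V} {t : ℝ} (ht : t ≤ F.len - dist F G) :
    F t = G t :=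
  apply_eq_of_le_commonLength (by linarith [dist_def F G, commonLength_le_right F G])

theorem lipschitzWith_len : LipschitzWith 1 (len : ReducedPath V → ℝ) :=
  LipschitzWith.mk_one fun F G => by
    rw [dist_def, Real.dist_eq, abs_le]
    constructor <;> linarith [commonLength_le_left F G, commonLength_le_right F G]

theorem lipschitzWith_apply (t : ℝ) : LipschitzWith 1 fun F : ReducedPath V => F t := by
  refine LipschitzWith.mk_one fun F G => ?_
  have hF := commonLength_le_left F G
  have hG := commonLength_le_right F G
  rw [dist_def]
  set c := commonLength F G with hc
  rcases le_total t c with h | h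
  · rw [apply_eq_of_le_commonLength h, dist_self]
    linarith
  · have tail : ∀ K : ReducedPath V, c ≤ K.len → ‖K t - K c‖ ≤ K.len - c := fun K hK => by
      rw [← K.apply_min_len t]
      refine (K.norm_apply_sub_le _ _).trans ?_
      rw [abs_of_nonneg (sub_nonneg.2 (le_min h hK))]
      exact sub_le_sub_right (min_le_right _ _) _
    calc dist (F t) (G t) = ‖(F t - F c) - (G t - G c)‖ := by
          rw [apply_eq_of_le_commonLength hc.le, sub_sub_sub_cancel_right, dist_eq_norm]
      _ ≤ ‖F t - F c‖ + ‖G t - G c‖ := norm_sub_le _ _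
      _ ≤ F.len + G.len - 2 * c := by linarith [tail F hF, tail G hG]

theorem lipschitzWith_endpoint : LipschitzWith 1 (endpoint : ReducedPath V → V) :=
  LipschitzWith.mk_one fun F G => by
    unfold endpoint
    rw [← F.of_len_le _ (le_max_left F.len G.len), ← G.of_len_le _ (le_max_right F.len G.len)]
    simpa using (lipschitzWith_apply _).dist_le_mul F G

/-- The initial subpath of length `r`. -/
def take (F : ReducedPath V) {r : ℝ} (hr : r ∈ Set.Icc 0 F.len) : ReducedPath V where
  toFun t := F (min t r)
  len := r
  len_nonneg := hr.1
  lipschitz := by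
    simpa [Function.comp_def] using F.lipschitz.comp (LipschitzWith.id.min_const r)
  of_nonpos t ht := F.of_nonpos _ ((min_le_left _ _).trans ht)
  of_len_le t ht := by rw [min_eq_right ht, min_self]
  reduced t ht := by
    refine ((F.reduced t ⟨ht.1, ht.2.trans_le hr.2⟩).and_eventually
      (Ioo_mem_nhdsGT (sub_pos.2 ht.2))).mono fun s hs => ?_
    obtain ⟨hne, h0, hs⟩ := hs
    rwa [min_eq_left (by linarith), min_eq_left (by linarith)]

section Take

variable (F G : ReducedPath V) {r t : ℝ} (hr : r ∈ Set.Icc 0 F.len)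

theorem take_apply (ht : t ≤ r) : F.take hr t = F t := by
  change F (min t r) = _
  rw [min_eq_left ht]

theorem len_take : (F.take hr).len = r := rfl

theorem endpoint_take : (F.take hr).endpoint = F r := take_apply F hr le_rfl

theorem commonLength_take : commonLength G (F.take hr) = min r (commonLength G F) := by
  apply le_antisymm
  · have h := commonLength_le_right G (F.take hr)
    refine le_min h (le_commonLength (commonLength_le_left _ _) (h.trans hr.2) fun u hu => ?_)
    rw [apply_eq_of_le_commonLength hu.2, take_apply F hr (hu.2.trans h)]
  · refine le_commonLength ((min_le_right _ _).trans (commonLength_le_left _ _))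
      (min_le_left _ _) fun u hu => ?_
    rw [take_apply F hr (hu.2.trans (min_le_left _ _)),
      apply_eq_of_le_commonLength (hu.2.trans (min_le_right _ _))]

theorem dist_take_self : dist F (F.take hr) = F.len - r := by
  rw [dist_def, commonLength_take, commonLength_self, min_eq_left hr.2, len_take]
  ring

theorem dist_take (h : commonLength G F ≤ r) :
    dist G (F.take hr) = dist G F - (F.len - r) := by
  rw [dist_def, dist_def, commonLength_take, min_eq_right h, len_take]
  ring

end Take

instance : Zero (ReducedPath V) :=
  ⟨{ toFun := 0
     len := 0
     len_nonneg := le_rfl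
     lipschitz := LipschitzWith.const' 0
     of_nonpos := fun _ _ => rfl
     of_len_le := fun _ _ => rfl
     reduced := by simp }⟩

theorem len_zero : (0 : ReducedPath V).len = 0 := rfl

theorem endpoint_zero : (0 : ReducedPath V).endpoint = 0 := rfl

theorem commonLength_zero (F : ReducedPath V) : commonLength F 0 = 0 :=
  (commonLength_le_right F 0).antisymm (commonLength_nonneg F 0)

theorem dist_zero (F : ReducedPath V) : dist 0 F = F.len := by
  rw [dist_comm, dist_def, commonLength_zero, len_zero]
  ring

theorem exists_dist_eq_of_le {F G : ReducedPath V} {s : ℝ} (h0 : 0 ≤ s)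
    (hs : s ≤ F.len - commonLength F G) :
    ∃ H : ReducedPath V, dist F H = s ∧ dist H G = dist F G - s := by
  have hc := commonLength_nonneg F G
  have hr : F.len - s ∈ Set.Icc 0 F.len := ⟨by linarith, by linarith⟩
  refine ⟨F.take hr, by rw [dist_take_self, sub_sub_cancel], ?_⟩
  rw [dist_comm, dist_take F G hr (by rw [commonLength_comm]; linarith), dist_comm, sub_sub_cancel]

theorem isZeroHyperbolic : IsZeroHyperbolic (ReducedPath V) where
  four_point F G H K := by
    have hFG := min_commonLength_le F H G
    have hFG' := min_commonLength_le F K G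
    have hHK := min_commonLength_le H F K
    have hHK' := min_commonLength_le H G K
    rw [commonLength_comm H G] at hFG hHK'
    rw [commonLength_comm K G] at hFG'
    rw [commonLength_comm H F] at hHK
    simp only [dist_def]
    by_contra! h
    obtain ⟨h, h'⟩ := max_lt_iff.1 h
    rcases min_le_iff.1 hFG with _ | _ <;> rcases min_le_iff.1 hFG' with _ | _ <;>
      rcases min_le_iff.1 hHK with _ | _ <;> rcases min_le_iff.1 hHK' with _ | _ <;> linarith
  exists_dist_eq F G s hs := by
    rcases le_total s (F.len - commonLength F G) with h | h
    · exact exists_dist_eq_of_le hs.1 h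
    · have hFG := dist_def F G
      obtain ⟨H, hGH, hHF⟩ := exists_dist_eq_of_le (F := G) (G := F) (s := dist F G - s)
        (sub_nonneg.2 hs.2) (by rw [commonLength_comm]; linarith)
      exact ⟨H, by rw [dist_comm, hHF, dist_comm, sub_sub_cancel], by rw [dist_comm, hGH]⟩

/-! ### Straight paths, completeness and cardinality -/

/-- The straight path from `0` to `w`, traversed with constant speed in time `l`. -/
noncomputable def line [NormedSpace ℝ V] {w : V} (hw : w ≠ 0) {l : ℝ} (hl : ‖w‖ ≤ l) :
    ReducedPath V where
  toFun t := max (min t l) 0 • l⁻¹ • w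
  len := l
  len_nonneg := (norm_nonneg w).trans hl
  lipschitz := by
    have hclamp : LipschitzWith 1 fun t : ℝ => max (min t l) 0 :=
      (LipschitzWith.id.min_const l).max_const 0
    have hspeed : ‖l⁻¹ • w‖ ≤ 1 := by
      rw [norm_smul, norm_inv, Real.norm_of_nonneg ((norm_nonneg w).trans hl), inv_mul_eq_div]
      exact div_le_one_of_le₀ hl ((norm_nonneg w).trans hl)
    refine LipschitzWith.mk_one fun s t => ?_
    rw [dist_eq_norm, ← sub_smul, norm_smul]
    refine (mul_le_of_le_one_right (norm_nonneg _) hspeed).trans ?_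
    rw [← dist_eq_norm]
    simpa only [NNReal.coe_one, one_mul] using hclamp.dist_le_mul s t
  of_nonpos t ht := by rw [max_eq_right ((min_le_left _ _).trans ht), zero_smul]
  of_len_le t ht := by rw [min_eq_right ht, min_self]
  reduced t ht := by
    have hl0 : 0 < l := ht.1.trans ht.2
    refine Eventually.frequently ?_
    filter_upwards [Ioo_mem_nhdsGT (lt_min ht.1 (sub_pos.2 ht.2))] with s hs h
    obtain ⟨hst, hsl⟩ := lt_min_iff.1 hs.2
    have hmax := smul_left_injective ℝ (smul_ne_zero (inv_ne_zero hl0.ne') hw) h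
    obtain ⟨hs0, -⟩ := hs
    rw [min_eq_left (by linarith), min_eq_left (by linarith), max_eq_left (by linarith),
      max_eq_left (by linarith)] at hmax
    linarith

section Line

variable [NormedSpace ℝ V] {w w' : V} (hw : w ≠ 0) (hw' : w' ≠ 0) {l t : ℝ} (hl : ‖w‖ ≤ l)
  (hl' : ‖w'‖ ≤ l)

theorem len_line : (line hw hl).len = l := rfl

theorem line_apply (ht : t ∈ Set.Icc 0 l) : line hw hl t = t • l⁻¹ • w := by
  change max (min t l) 0 • l⁻¹ • w = _
  rw [min_eq_left ht.2, max_eq_left ht.1]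

theorem endpoint_line : (line hw hl).endpoint = w := by
  have hl0 : 0 < l := (norm_pos_iff.2 hw).trans_le hl
  rw [endpoint, len_line, line_apply hw hl ⟨hl0.le, le_rfl⟩, smul_inv_smul₀ hl0.ne']

theorem dist_line (h : w ≠ w') : dist (line hw hl) (line hw' hl') = l + l := by
  have hl0 : 0 < l := (norm_pos_iff.2 hw).trans_le hl
  have hc : commonLength (line hw hl) (line hw' hl') = 0 := by
    refine commonLength_eq hl0.le hl0.le (fun u hu => ?_) fun _ _ => Eventually.frequently ?_
    · rw [of_nonpos _ u hu.2, of_nonpos _ u hu.2]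
    · filter_upwards [Ioo_mem_nhdsGT hl0] with u hu huw
      rw [zero_add, line_apply hw hl ⟨hu.1.le, hu.2.le⟩,
        line_apply hw' hl' ⟨hu.1.le, hu.2.le⟩] at huw
      exact h (smul_right_injective V (inv_ne_zero hl0.ne')
        (smul_right_injective V hu.1.ne' huw))
  rw [dist_def, hc, len_line, len_line]
  ring

end Line

theorem eventually_eqOn_of_cauchySeq {x : ℕ → ReducedPath V} (hx : CauchySeq x) {f : ℝ → V}
    (hf : ∀ t, Tendsto (fun n => x n t) atTop (𝓝 (f t))) {ε : ℝ} (hε : 0 < ε) :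
    ∀ᶠ n in atTop, ∀ t ≤ (x n).len - ε, x n t = f t := by
  obtain ⟨N, hN⟩ := Metric.cauchySeq_iff.1 hx ε hε
  filter_upwards [eventually_ge_atTop N] with n hn t ht
  refine tendsto_nhds_unique (tendsto_const_nhds.congr' ?_) (hf t)
  filter_upwards [eventually_ge_atTop N] with m hm
  exact apply_eq_of_le_len_sub_dist (by linarith [hN n hn m hm])

theorem exists_tendsto_apply_of_cauchySeq [CompleteSpace V] {x : ℕ → ReducedPath V}
    (hx : CauchySeq x) :
    ∃ F : ReducedPath V, (∀ t, Tendsto (fun n => x n t) atTop (𝓝 (F t))) ∧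
      Tendsto (fun n => (x n).len) atTop (𝓝 F.len) := by
  choose f hf using fun t =>
    cauchySeq_tendsto_of_complete ((lipschitzWith_apply t).uniformContinuous.comp_cauchySeq hx)
  obtain ⟨l, hl⟩ :=
    cauchySeq_tendsto_of_complete (lipschitzWith_len.uniformContinuous.comp_cauchySeq hx)
  simp only [Function.comp_def] at hf hl
  refine ⟨⟨f, l, ge_of_tendsto' hl fun n => (x n).len_nonneg, ?_, fun t ht => ?_, fun t ht => ?_,
    fun t ht => ?_⟩, hf, hl⟩
  · exact (isClosed_setOfPred_lipschitzWith 1).mem_of_tendsto (tendsto_pi_nhds.2 hf)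
      (Eventually.of_forall fun n => (x n).lipschitz)
  · exact tendsto_nhds_unique (hf t) (tendsto_const_nhds.congr fun n => ((x n).of_nonpos t ht).symm)
  · have hbound : ∀ n, ‖x n t - x n l‖ ≤ |min t (x n).len - min l (x n).len| := fun n => by
      rw [← (x n).apply_min_len t, ← (x n).apply_min_len l]
      exact (x n).norm_apply_sub_le _ _
    have hlim := le_of_tendsto_of_tendsto' ((hf t).sub (hf l)).norm
      ((tendsto_const_nhds.min hl).sub (tendsto_const_nhds.min hl)).abs hbound
    rw [min_eq_right ht, min_self, sub_self, abs_zero] at hlim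
    exact sub_eq_zero.1 (norm_le_zero_iff.1 hlim)
  · have hgap : 0 < (l - t) / 3 := by linarith [ht.2]
    obtain ⟨n, hn, hlen⟩ := ((eventually_eqOn_of_cauchySeq hx hf hgap).and
      (hl.eventually (lt_mem_nhds (show l - (l - t) / 3 < l by linarith)))).exists
    refine (((x n).reduced t ⟨ht.1, by linarith⟩).and_eventually
      (Ioo_mem_nhdsGT hgap)).mono fun s ⟨hs, h0, hst⟩ => ?_
    rwa [← hn _ (by linarith), ← hn _ (by linarith)]

instance [CompleteSpace V] : CompleteSpace (ReducedPath V) := by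
  refine Metric.complete_of_cauchySeq_tendsto fun x hx => ?_
  obtain ⟨F, hF, hlen⟩ := exists_tendsto_apply_of_cauchySeq hx
  refine ⟨F, Metric.tendsto_atTop'.2 fun ε hε => ?_⟩
  have hε4 : 0 < ε / 4 := by linarith
  refine (((eventually_eqOn_of_cauchySeq hx hF hε4).and
    (Metric.tendsto_nhds.1 hlen _ hε4)).exists_forall_of_atTop).imp fun N hN n hn => ?_
  obtain ⟨heq, hclose⟩ := hN n hn.le
  rw [Real.dist_eq, abs_lt] at hclose
  have hc : (x n).len - ε / 4 ≤ commonLength (x n) F :=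
    le_commonLength (by linarith) (by linarith) fun u hu => heq u hu.2
  rw [dist_def]
  linarith

theorem mk_le_continuum {W : Type u} [NormedAddCommGroup W] (hW : #W ≤ 𝔠) :
    #(ReducedPath W) ≤ 𝔠 := by
  have hinj : Function.Injective fun F : ReducedPath W => (F.len, fun q : ℚ => F q) := by
    intro F G h
    rw [Prod.mk.injEq] at h
    exact ReducedPath.ext (Rat.denseRange_cast.equalizer F.lipschitz.continuous
      G.lipschitz.continuous h.2) h.1
  calc #(ReducedPath W) ≤ #(ℝ × (ℚ → W)) := mk_le_of_injective hinj
    _ = 𝔠 * #W ^ ℵ₀ := by simp [mk_real]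
    _ ≤ 𝔠 * 𝔠 ^ ℵ₀ := mul_le_mul_right (power_le_power_right hW) _
    _ = 𝔠 := by simp

/-! ### Reduced concatenation and translations -/

/-- The path traversed backwards, translated so as to start at `0`. -/
def reverse (W : ReducedPath V) : ReducedPath V where
  toFun t := W (W.len - t) - W.endpoint
  len := W.len
  len_nonneg := W.len_nonneg
  lipschitz := LipschitzWith.mk_one fun s t => by
    rw [dist_sub_right, dist_eq_norm, dist_comm]
    refine (W.norm_apply_sub_le _ _).trans_eq ?_
    rw [sub_sub_sub_cancel_left, Real.dist_eq]
  of_nonpos t ht := by rw [W.of_len_le _ (by linarith), endpoint, sub_self]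
  of_len_le t ht := by rw [W.of_nonpos _ (by linarith), W.of_nonpos _ (sub_self _).le]
  reduced t ht := by
    refine (W.reduced (W.len - t) ⟨sub_pos.2 ht.2, sub_lt_self _ ht.1⟩).mono fun s hs h => hs ?_
    rw [← sub_sub, ← sub_add] at h
    exact (sub_left_injective h).symm

theorem reverse_apply (W : ReducedPath V) (t : ℝ) :
    W.reverse t = W (W.len - t) - W.endpoint := rfl

theorem len_reverse (W : ReducedPath V) : W.reverse.len = W.len := rfl

theorem endpoint_reverse (W : ReducedPath V) : W.reverse.endpoint = -W.endpoint := by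
  rw [endpoint, len_reverse, reverse_apply, W.of_nonpos _ (sub_self _).le, zero_sub]

theorem reverse_reverse (W : ReducedPath V) : W.reverse.reverse = W := by
  refine ReducedPath.ext (funext fun t => ?_) rfl
  rw [reverse_apply, endpoint_reverse, reverse_apply, len_reverse, sub_sub_cancel, sub_neg_eq_add,
    sub_add_cancel]

/-- The length of the part of `F` that cancels against the end of `W` when `F` is appended
to `W`. -/
noncomputable def cancelLength (W F : ReducedPath V) : ℝ := commonLength W.reverse F

section Concat

variable (W F : ReducedPath V) {t : ℝ}

theorem cancelLength_nonneg : 0 ≤ cancelLength W F := commonLength_nonneg _ _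

theorem cancelLength_le_left : cancelLength W F ≤ W.len := commonLength_le_left W.reverse F

theorem cancelLength_le_right : cancelLength W F ≤ F.len := commonLength_le_right _ _

theorem apply_len_sub_of_le_cancelLength (ht : t ≤ cancelLength W F) :
    W (W.len - t) = W.endpoint + F t := by
  rw [← apply_eq_of_le_commonLength ht, reverse_apply, add_sub_cancel]

/-- The function underlying `W.concat F`: it follows `W` up to the time where the cancellation
starts, and then the translate of what remains of `F`. -/
noncomputable def concatFun (t : ℝ) : V :=
  W (min t (W.len - cancelLength W F)) +
    (F (max t (W.len - cancelLength W F) - W.len + 2 * cancelLength W F) - F (cancelLength W F))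

theorem concatFun_of_le (ht : t ≤ W.len - cancelLength W F) : concatFun W F t = W t := by
  rw [concatFun, min_eq_left ht, max_eq_right ht]
  ring_nf
  rw [sub_self, add_zero]

theorem concatFun_of_ge (ht : W.len - cancelLength W F ≤ t) :
    concatFun W F t = W.endpoint + F (t - W.len + 2 * cancelLength W F) := by
  rw [concatFun, min_eq_right ht, max_eq_left ht, apply_len_sub_of_le_cancelLength W F le_rfl,
    add_add_sub_cancel]

theorem lipschitzWith_concatFun : LipschitzWith 1 (concatFun W F) := by
  refine LipschitzWith.mk_one fun s t => ?_
  wlog hst : s ≤ t generalizing s t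
  · rw [dist_comm, dist_comm s]
    exact this t s (le_of_not_ge hst)
  set a := W.len - cancelLength W F
  have hmin : min s a ≤ min t a := min_le_min_right a hst
  have hmax : max s a ≤ max t a := max_le_max_right a hst
  calc dist (concatFun W F s) (concatFun W F t)
      ≤ |min s a - min t a| + |max s a - max t a| := by
        refine (dist_add_add_le _ _ _ _).trans (add_le_add ?_ ?_)
        · rw [dist_eq_norm]
          exact W.norm_apply_sub_le _ _
        · rw [dist_sub_right, dist_eq_norm]
          refine (F.norm_apply_sub_le _ _).trans_eq ?_
          rw [add_sub_add_right_eq_sub, sub_sub_sub_cancel_right]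
    _ = dist s t := by
        rw [abs_sub_comm, abs_of_nonneg (sub_nonneg.2 hmin), abs_sub_comm,
          abs_of_nonneg (sub_nonneg.2 hmax), Real.dist_eq, abs_sub_comm,
          abs_of_nonneg (sub_nonneg.2 hst)]
        linarith [min_add_max s a, min_add_max t a]

theorem frequently_concatFun_ne (ht : t ∈ Set.Ioo 0 (W.len + F.len - 2 * cancelLength W F)) :
    ∃ᶠ s in 𝓝[>] (0 : ℝ), concatFun W F (t + s) ≠ concatFun W F (t - s) := by
  have hc := cancelLength_nonneg W F
  obtain ⟨ht0, ht1⟩ := ht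
  rcases lt_trichotomy t (W.len - cancelLength W F) with h | h | h
  · refine ((W.reduced t ⟨ht0, by linarith⟩).and_eventually
      (Ioo_mem_nhdsGT (sub_pos.2 h))).mono fun s ⟨hs, h0, hst⟩ => ?_
    rwa [concatFun_of_le _ _ (by linarith), concatFun_of_le _ _ (by linarith)]
  · have hleft : cancelLength W F < W.reverse.len := by rw [len_reverse]; linarith
    have hright : cancelLength W F < F.len := by linarith
    refine ((frequently_ne_of_commonLength_lt hleft hright).and_eventually
      self_mem_nhdsWithin).mono fun s ⟨hs, h0⟩ heq => hs ?_
    have h0 : 0 < s := h0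
    change W.reverse (cancelLength W F + s) = F (cancelLength W F + s)
    rw [concatFun_of_ge _ _ (by linarith), concatFun_of_le _ _ (by linarith)] at heq
    rw [reverse_apply, ← sub_sub, ← h, ← heq, add_sub_cancel_left, h]
    ring_nf
  · refine ((F.reduced (t - W.len + 2 * cancelLength W F) ⟨by linarith, by linarith⟩).and_eventually
      (Ioo_mem_nhdsGT (sub_pos.2 h))).mono fun s ⟨hs, h0, hst⟩ heq => hs ?_
    rw [concatFun_of_ge _ _ (by linarith), concatFun_of_ge _ _ (by linarith)] at heq
    convert add_left_cancel heq using 2 <;> ring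

/-- The reduced concatenation of `W` and `F`, the group law on reduced paths. -/
noncomputable def concat : ReducedPath V where
  toFun := concatFun W F
  len := W.len + F.len - 2 * cancelLength W F
  len_nonneg := by linarith [cancelLength_le_left W F, cancelLength_le_right W F]
  lipschitz := lipschitzWith_concatFun W F
  of_nonpos t ht := by
    rw [concatFun_of_le _ _ (by linarith [cancelLength_le_left W F]), W.of_nonpos t ht]
  of_len_le t ht := by
    have hc := cancelLength_le_right W F
    rw [concatFun_of_ge _ _ (by linarith), concatFun_of_ge _ _ (by linarith),
      F.of_len_le (t - _ + _) (by linarith)]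
    ring_nf
  reduced _ := frequently_concatFun_ne W F

theorem len_concat : (W.concat F).len = W.len + F.len - 2 * cancelLength W F := rfl

theorem concat_apply_of_le (ht : t ≤ W.len - cancelLength W F) : W.concat F t = W t :=
  concatFun_of_le W F ht

theorem concat_apply_of_ge (ht : W.len - cancelLength W F ≤ t) :
    W.concat F t = W.endpoint + F (t - W.len + 2 * cancelLength W F) :=
  concatFun_of_ge W F ht

theorem endpoint_concat : (W.concat F).endpoint = W.endpoint + F.endpoint := by
  have hc := cancelLength_le_right W F
  rw [endpoint, concat_apply_of_ge _ _ (by rw [len_concat]; linarith), len_concat]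
  change _ = _ + F F.len
  ring_nf

theorem concat_zero : W.concat 0 = W := by
  have hc : cancelLength W 0 = 0 := commonLength_zero _
  have hlen : (W.concat 0).len = W.len := by rw [len_concat, hc, len_zero]; ring
  refine eq_of_eqOn hlen fun t ht => concat_apply_of_le _ _ ?_
  rw [hc, sub_zero, ← hlen]
  exact ht.2

theorem commonLength_concat : commonLength W (W.concat F) = W.len - cancelLength W F := by
  have hc := cancelLength_nonneg W F
  have hcF := cancelLength_le_right W F
  refine commonLength_eq (by linarith) (by rw [len_concat]; linarith)
    (fun u hu => (concat_apply_of_le _ _ hu.2).symm) fun hW hF => ?_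
  rw [len_concat] at hF
  refine ((F.reduced (cancelLength W F) ⟨by linarith, by linarith⟩).and_eventually
    (Ioo_mem_nhdsGT (by linarith : 0 < cancelLength W F))).mono fun s ⟨hs, h0, hsc⟩ heq => hs ?_
  rw [concat_apply_of_ge _ _ (by linarith),
    show W.len - cancelLength W F + s = W.len - (cancelLength W F - s) by ring,
    apply_len_sub_of_le_cancelLength W F (by linarith)] at heq
  convert (add_left_cancel heq).symm using 2
  ring

theorem cancelLength_reverse_concat :
    cancelLength W.reverse (W.concat F) = W.len - cancelLength W F := by
  rw [cancelLength, reverse_reverse, commonLength_concat]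

theorem reverse_concat_concat : W.reverse.concat (W.concat F) = F := by
  have hlen : (W.reverse.concat (W.concat F)).len = F.len := by
    rw [len_concat, len_concat, cancelLength_reverse_concat, len_reverse]
    ring
  have hcancel := cancelLength_reverse_concat W F
  have hW := len_reverse W
  refine eq_of_eqOn hlen fun t _ => ?_
  rcases le_total t (cancelLength W F) with h | h
  · rw [concat_apply_of_le _ _ (by linarith), reverse_apply,
      apply_len_sub_of_le_cancelLength W F h, add_sub_cancel_left]
  · rw [concat_apply_of_ge _ _ (by linarith), endpoint_reverse, hcancel, hW,
      concat_apply_of_ge _ _ (by linarith), neg_add_cancel_left]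
    ring_nf

theorem dist_concat_take_le {r : ℝ} (hr : r ∈ Set.Icc 0 F.len) :
    dist (W.concat F) (W.concat (F.take hr)) ≤ F.len - r := by
  have hcF := cancelLength_le_right W F
  have hmin : cancelLength W (F.take hr) = min r (cancelLength W F) := commonLength_take _ _ hr
  rw [dist_def, len_concat, len_concat, len_take]
  rcases le_total r (cancelLength W F) with h | h
  · rw [min_eq_left h] at hmin
    have hcommon : W.len - cancelLength W F ≤
        commonLength (W.concat F) (W.concat (F.take hr)) := by
      refine le_commonLength ?_ ?_ fun u hu => ?_
      · rw [len_concat]; linarith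
      · rw [len_concat, len_take]; linarith
      · rw [concat_apply_of_le _ _ hu.2, concat_apply_of_le _ _ (by linarith [hu.2])]
    linarith
  · rw [min_eq_right h] at hmin
    have hcommon : W.len + r - 2 * cancelLength W F ≤
        commonLength (W.concat F) (W.concat (F.take hr)) := by
      refine le_commonLength ?_ ?_ fun u hu => ?_
      · rw [len_concat]; linarith [hr.2]
      · rw [len_concat, len_take]; linarith
      · rcases le_total u (W.len - cancelLength W F) with hu' | hu'
        · rw [concat_apply_of_le _ _ hu', concat_apply_of_le _ _ (by linarith)]
        · rw [concat_apply_of_ge _ _ hu', concat_apply_of_ge _ _ (by linarith), hmin,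
            take_apply _ _ (by linarith [hu.2])]
    linarith

theorem commonLength_mem_Icc_left (F G : ReducedPath V) : commonLength F G ∈ Set.Icc 0 F.len :=
  ⟨commonLength_nonneg F G, commonLength_le_left F G⟩

theorem commonLength_mem_Icc_right (F G : ReducedPath V) : commonLength F G ∈ Set.Icc 0 G.len :=
  ⟨commonLength_nonneg F G, commonLength_le_right F G⟩

theorem take_commonLength (F G : ReducedPath V) :
    F.take (commonLength_mem_Icc_left F G) = G.take (commonLength_mem_Icc_right F G) :=
  eq_of_eqOn rfl fun t ht => by
    have ht : t ≤ commonLength F G := ht.2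
    rw [take_apply _ _ ht, take_apply _ _ ht, apply_eq_of_le_commonLength ht]

theorem dist_concat_le (G : ReducedPath V) : dist (W.concat F) (W.concat G) ≤ dist F G := by
  have hF := dist_concat_take_le W F (commonLength_mem_Icc_left F G)
  have hG := dist_concat_take_le W G (commonLength_mem_Icc_right F G)
  rw [take_commonLength] at hF
  have htriangle := dist_triangle_right (W.concat F) (W.concat G)
    (W.concat (G.take (commonLength_mem_Icc_right F G)))
  rw [dist_def F G]
  linarith

end Concat

/-- Left translation by `W` for the group law given by reduced concatenation. -/
noncomputable def translate (W : ReducedPath V) : ReducedPath V ≃ᵢ ReducedPath V where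
  toFun := W.concat
  invFun := W.reverse.concat
  left_inv := reverse_concat_concat W
  right_inv F := by simpa only [reverse_reverse] using reverse_concat_concat W.reverse F
  isometry_toFun := Isometry.of_dist_eq fun F G => by
    refine le_antisymm (dist_concat_le W F G) ?_
    simpa only [reverse_concat_concat] using dist_concat_le W.reverse (W.concat F) (W.concat G)

theorem translate_zero (W : ReducedPath V) : W.translate 0 = W := concat_zero W

theorem translate_inv_apply_self (W : ReducedPath V) : W.translate⁻¹ W = 0 := by
  conv_lhs => enter [2]; rw [← translate_zero W]
  exact W.translate.inv_apply_self 0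

theorem endpoint_translate (W F : ReducedPath V) :
    (W.translate F).endpoint = W.endpoint + F.endpoint := endpoint_concat W F

section Map

variable [NormedSpace ℝ V]

/-- The image of a path under a linear isometry. -/
def map (U : V ≃ₗᵢ[ℝ] V) (F : ReducedPath V) : ReducedPath V where
  toFun t := U (F t)
  len := F.len
  len_nonneg := F.len_nonneg
  lipschitz := by simpa [Function.comp_def] using U.lipschitz.comp F.lipschitz
  of_nonpos t ht := by rw [F.of_nonpos t ht, U.map_zero]
  of_len_le t ht := by rw [F.of_len_le t ht]
  reduced t ht := (F.reduced t ht).mono fun _ hs h => hs (U.injective h)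

theorem commonLength_map (U : V ≃ₗᵢ[ℝ] V) (F G : ReducedPath V) :
    commonLength (map U F) (map U G) = commonLength F G := by
  apply le_antisymm
  · exact le_commonLength (commonLength_le_left (map U F) _) (commonLength_le_right _ (map U G))
      fun u hu => U.injective (apply_eq_of_le_commonLength hu.2)
  · exact le_commonLength (commonLength_le_left F G) (commonLength_le_right F G)
      fun u hu => congrArg U (apply_eq_of_le_commonLength hu.2)

/-- The isometry of the tree of reduced paths induced by a linear isometry. -/
def mapIsometry (U : V ≃ₗᵢ[ℝ] V) : ReducedPath V ≃ᵢ ReducedPath V where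
  toFun := map U
  invFun := map U.symm
  left_inv _ := ReducedPath.ext (funext fun _ => U.symm_apply_apply _) rfl
  right_inv _ := ReducedPath.ext (funext fun _ => U.apply_symm_apply _) rfl
  isometry_toFun := Isometry.of_dist_eq fun F G => by
    rw [dist_def, commonLength_map]
    rfl

theorem mapIsometry_zero (U : V ≃ₗᵢ[ℝ] V) : mapIsometry U 0 = 0 :=
  ReducedPath.ext (funext fun _ => U.map_zero) rfl

theorem endpoint_mapIsometry (U : V ≃ₗᵢ[ℝ] V) (F : ReducedPath V) :
    (mapIsometry U F).endpoint = U F.endpoint := rfl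

end Map

section Spoke

variable {V : Type u} [NormedAddCommGroup V] [NormedSpace ℝ V] (F : ReducedPath V) {w w' : V}
  (hw : w ≠ 0) (hw' : w' ≠ 0) {l : ℝ} (hl : ‖w‖ ≤ l) (hl' : ‖w'‖ ≤ l)

/-- The point reached from `F` by moving along the straight path with displacement `w` during
time `l`. Spokes at `F` with different displacements and the same duration leave `F` in different
directions. -/
noncomputable def spoke : ReducedPath V := F.translate (line hw hl)

theorem dist_spoke : dist F (F.spoke hw hl) = l := by
  conv_lhs => enter [1]; rw [← translate_zero F]
  rw [spoke, IsometryEquiv.dist_eq, dist_zero, len_line]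

theorem endpoint_spoke : (F.spoke hw hl).endpoint = F.endpoint + w := by
  rw [spoke, endpoint_translate, endpoint_line]

theorem isBetween_spoke (h : w ≠ w') : IsBetween (F.spoke hw hl) F (F.spoke hw' hl') := by
  rw [IsBetween, dist_comm, dist_spoke, dist_spoke, spoke, spoke, IsometryEquiv.dist_eq,
    dist_line hw hw' hl hl' h]

theorem hasUnboundedTripods [Nontrivial V] : HasUnboundedTripods (ReducedPath V) := by
  intro F r
  obtain ⟨v, hv⟩ := exists_ne (0 : V)
  have hw : ∀ i : Fin 3, ((i : ℝ) + 1) • v ≠ 0 := fun i => smul_ne_zero (by positivity) hv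
  have hl : ∀ i : Fin 3, ‖((i : ℝ) + 1) • v‖ ≤ 3 * ‖v‖ + |r| + 1 := fun i => by
    have hi : (i : ℝ) + 1 ≤ 3 := by exact_mod_cast i.isLt
    rw [norm_smul, Real.norm_of_nonneg (by positivity)]
    linarith [mul_le_mul_of_nonneg_right hi (norm_nonneg v), abs_nonneg r]
  refine ⟨fun i => F.spoke (hw i) (hl i), fun i => ?_, fun i j hij => ?_⟩
  · rw [dist_spoke]
    linarith [le_abs_self r, norm_nonneg v]
  · refine isBetween_spoke F (hw i) (hw j) (hl i) (hl j) fun h => hij (Fin.ext ?_)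
    exact_mod_cast add_right_cancel (smul_left_injective ℝ hv h)

theorem hasValence [Nontrivial V] (hV : #V ≤ 𝔠) : HasValence (ReducedPath V) 𝔠 := by
  refine fun F => le_antisymm ?_ ?_
  · exact (mk_le_of_surjective Quot.mk_surjective).trans
      ((mk_subtype_le _).trans (mk_le_continuum hV))
  · let s : Set V := Metric.ball 0 1 ∩ {0}ᶜ
    have hs : s.Nonempty := (dense_compl_singleton (0 : V)).inter_open_nonempty _
      Metric.isOpen_ball ⟨0, Metric.mem_ball_self one_pos⟩
    have hl : ∀ w : s, ‖(w : V)‖ ≤ 1 := fun w => (mem_ball_zero_iff.1 w.2.1).le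
    refine (continuum_le_cardinal_of_isOpen ℝ
      (Metric.isOpen_ball.inter isOpen_compl_singleton) hs).trans
      (isZeroHyperbolic.mk_le_mk_direction (fun w : s => F.spoke w.2.2 (hl w)) (fun w h => ?_)
        fun w w' h => isBetween_spoke F w.2.2 w'.2.2 (hl w) (hl w') (Subtype.coe_injective.ne h))
    have hdist := F.dist_spoke w.2.2 (hl w)
    rw [h, dist_self] at hdist
    exact zero_ne_one hdist

end Spoke

/-! ### Linear parts -/

section LinearPart

variable {V : Type*} [NormedAddCommGroup V] [NormedSpace ℝ V]

/-- The isometry `g` of the tree of reduced paths covers an affine isometry of `V`, with linear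
part `U`, under the endpoint projection. -/
def HasLinearPart (g : ReducedPath V ≃ᵢ ReducedPath V) (U : V ≃ₗᵢ[ℝ] V) : Prop :=
  ∀ F G, (g F).endpoint - (g G).endpoint = U (F.endpoint - G.endpoint)

theorem hasLinearPart_translate (W : ReducedPath V) : HasLinearPart W.translate 1 := fun F G => by
  rw [endpoint_translate, endpoint_translate, add_sub_add_left_eq_sub]
  rfl

theorem hasLinearPart_mapIsometry (U : V ≃ₗᵢ[ℝ] V) : HasLinearPart (mapIsometry U) U := by
  intro F G
  rw [endpoint_mapIsometry, endpoint_mapIsometry, map_sub]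

theorem hasLinearPart_one : HasLinearPart (1 : ReducedPath V ≃ᵢ ReducedPath V) 1 := fun _ _ => rfl

theorem exists_endpoint_eq (v : V) : ∃ F : ReducedPath V, F.endpoint = v := by
  rcases eq_or_ne v 0 with rfl | hv
  · exact ⟨0, endpoint_zero⟩
  · exact ⟨line hv le_rfl, endpoint_line hv le_rfl⟩

namespace HasLinearPart

variable {g h : ReducedPath V ≃ᵢ ReducedPath V} {U U' : V ≃ₗᵢ[ℝ] V} {F : ReducedPath V}

theorem mul (hg : HasLinearPart g U) (hh : HasLinearPart h U') : HasLinearPart (g * h) (U * U') :=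
  fun F G => (hg (h F) (h G)).trans (congrArg U (hh F G))

theorem inv (hg : HasLinearPart g U) : HasLinearPart g⁻¹ U⁻¹ := fun F G => by
  have hFG := hg (g⁻¹ F) (g⁻¹ G)
  rw [IsometryEquiv.apply_inv_self, IsometryEquiv.apply_inv_self] at hFG
  rw [hFG]
  exact (U.symm_apply_apply _).symm

theorem endpoint_apply (hg : HasLinearPart g 1) (F : ReducedPath V) :
    (g F).endpoint = F.endpoint + (g 0).endpoint := by
  have hF : (g F).endpoint - (g 0).endpoint = F.endpoint - endpoint 0 := hg F 0
  rw [endpoint_zero, sub_zero] at hF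
  exact sub_eq_iff_eq_add.1 hF

theorem eq_one_of_one (hU : HasLinearPart (1 : ReducedPath V ≃ᵢ ReducedPath V) U) : U = 1 := by
  ext v
  obtain ⟨F, rfl⟩ := exists_endpoint_eq v
  have hF : F.endpoint - endpoint 0 = U (F.endpoint - endpoint 0) := hU F 0
  rw [endpoint_zero, sub_zero] at hF
  exact hF.symm

theorem eq_one_of_apply_zero (hg : HasLinearPart g 1) (h0 : g 0 = 0) : g = 1 := by
  have hlen : ∀ F, (g F).len = F.len := fun F => by
    rw [← dist_zero (g F), ← dist_zero F, ← g.dist_eq 0 F, h0]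
  ext1 F
  refine eq_of_eqOn (hlen F) fun t ht => ?_
  have ht' : t ∈ Set.Icc 0 F.len := hlen F ▸ ht
  have htake : g (F.take ht') = (g F).take ht := by
    refine isZeroHyperbolic.eq_of_isBetween (x := 0) (z := g F) ?_ ?_ ?_
    · rw [← h0]
      refine IsBetween.map g ?_
      rw [IsBetween, dist_zero, dist_zero, dist_comm, dist_take_self, len_take]
      ring
    · rw [IsBetween, dist_zero, dist_zero, dist_comm, dist_take_self, len_take]
      ring
    · rw [dist_zero, dist_zero, hlen, len_take, len_take]
  calc g F t = (g (F.take ht')).endpoint := by rw [htake, endpoint_take]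
    _ = F t := by rw [hg.endpoint_apply, h0, endpoint_zero, add_zero, endpoint_take]

theorem eq_one_of_apply_eq_self (hg : HasLinearPart g 1) (hF : g F = F) : g = 1 := by
  have hconj : F.translate⁻¹ * g * F.translate = 1 := by
    refine eq_one_of_apply_zero (((hasLinearPart_translate F).inv.mul hg).mul
      (hasLinearPart_translate F)) ?_
    rw [IsometryEquiv.mul_apply, IsometryEquiv.mul_apply, translate_zero, hF,
      translate_inv_apply_self]
  rwa [mul_assoc, inv_mul_eq_one, right_eq_mul] at hconj

end HasLinearPart

theorem exists_hasLinearPart_apply_eq (U : V ≃ₗᵢ[ℝ] V) (F G : ReducedPath V) :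
    ∃ g, HasLinearPart g U ∧ g F = G := by
  refine ⟨G.translate * mapIsometry U * F.translate⁻¹, ?_, ?_⟩
  · simpa using ((hasLinearPart_translate G).mul (hasLinearPart_mapIsometry U)).mul
      (hasLinearPart_translate F).inv
  · rw [IsometryEquiv.mul_apply, IsometryEquiv.mul_apply, translate_inv_apply_self,
      mapIsometry_zero, translate_zero]

end LinearPart

/-! ### The twisted group -/

section TwistedGroup

open Multiplicative (ofAdd)

variable {V : Type u} [NormedAddCommGroup V] [NormedSpace ℝ V]
  {θ : Multiplicative V →* (V ≃ₗᵢ[ℝ] V)}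

/-- The pairs of isometries of the tree of reduced paths whose first component covers a translation
of `V`, by `v` say, and whose second component covers an affine isometry with linear part `θ v`. -/
def twistedGroup (θ : Multiplicative V →* (V ≃ₗᵢ[ℝ] V)) :
    Subgroup ((ReducedPath V ≃ᵢ ReducedPath V) × (ReducedPath V ≃ᵢ ReducedPath V)) where
  carrier := {g | HasLinearPart g.1 1 ∧ HasLinearPart g.2 (θ (ofAdd (g.1 0).endpoint))}
  one_mem' := by
    refine ⟨hasLinearPart_one, ?_⟩
    change HasLinearPart 1 (θ (ofAdd (endpoint 0)))
    rw [endpoint_zero, ofAdd_zero, map_one]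
    exact hasLinearPart_one
  mul_mem' := by
    rintro g h ⟨hg₁, hg₂⟩ ⟨hh₁, hh₂⟩
    refine ⟨hg₁.mul hh₁, ?_⟩
    change HasLinearPart (g.2 * h.2) (θ (ofAdd (g.1 (h.1 0)).endpoint))
    rw [hg₁.endpoint_apply, add_comm, ofAdd_add, map_mul]
    exact hg₂.mul hh₂
  inv_mem' := by
    rintro g ⟨hg₁, hg₂⟩
    refine ⟨hg₁.inv, ?_⟩
    have h0 := hg₁.endpoint_apply (g.1⁻¹ 0)
    rw [IsometryEquiv.apply_inv_self, endpoint_zero] at h0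
    change HasLinearPart g.2⁻¹ (θ (ofAdd (g.1⁻¹ 0).endpoint))
    rw [eq_neg_of_add_eq_zero_left h0.symm, ofAdd_neg, map_inv]
    exact hg₂.inv

theorem eq_one_of_mem_twistedGroup
    {g : (ReducedPath V ≃ᵢ ReducedPath V) × (ReducedPath V ≃ᵢ ReducedPath V)}
    (hg : g ∈ twistedGroup θ) {F G : ReducedPath V} (hF : g.1 F = F) (hG : g.2 G = G) : g = 1 := by
  obtain ⟨hg₁, hg₂⟩ := hg
  have h₁ : g.1 = 1 := hg₁.eq_one_of_apply_eq_self hF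
  rw [h₁, IsometryEquiv.coe_one, id, endpoint_zero, ofAdd_zero, map_one] at hg₂
  exact Prod.ext h₁ (hg₂.eq_one_of_apply_eq_self hG)

theorem exists_mem_twistedGroup_apply_eq (F F' G G' : ReducedPath V) :
    ∃ g ∈ twistedGroup θ, g.1 F = F' ∧ g.2 G = G' := by
  obtain ⟨g, hg, hgF⟩ := exists_hasLinearPart_apply_eq 1 F F'
  obtain ⟨h, hh, hhG⟩ := exists_hasLinearPart_apply_eq (θ (ofAdd (g 0).endpoint)) G G'
  exact ⟨(g, h), ⟨hg, hh⟩, hgF, hhG⟩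

theorem inl_mem_twistedGroup {g : ReducedPath V ≃ᵢ ReducedPath V} (hg : HasLinearPart g 1)
    (hθ : θ (ofAdd (g 0).endpoint) = 1) : MonoidHom.inl _ _ g ∈ twistedGroup θ :=
  ⟨hg, by rw [MonoidHom.inl_apply, hθ]; exact hasLinearPart_one⟩

theorem inr_mem_twistedGroup {h : ReducedPath V ≃ᵢ ReducedPath V} (hh : HasLinearPart h 1) :
    MonoidHom.inr _ _ h ∈ twistedGroup θ := by
  refine ⟨hasLinearPart_one, ?_⟩
  rw [MonoidHom.inr_apply, IsometryEquiv.coe_one, id, endpoint_zero, ofAdd_zero, map_one]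
  exact hh

section Irreducibility

variable {ι κ : Type*}
  {p : ι → (ReducedPath V ≃ᵢ ReducedPath V) × (ReducedPath V ≃ᵢ ReducedPath V)}
  {q : κ → (ReducedPath V ≃ᵢ ReducedPath V) × (ReducedPath V ≃ᵢ ReducedPath V)}
  {R : ℝ}

theorem forall_fst_eq_one_or [Nontrivial V] (hp : ∀ i, p i ∈ twistedGroup θ)
    (hcomm : ∀ i j, Commute (p i) (q j)) (hR : ∀ F, ∃ i j, dist F ((p i * q j).1 0) ≤ R) :
    (∀ i, (p i).1 = 1) ∨ ∀ j, (q j).1 = 1 := by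
  refine or_iff_not_imp_left.2 fun h => ?_
  obtain ⟨i₀, hi₀⟩ := not_forall.1 h
  exact isZeroHyperbolic.eq_one_of_cobounded (fun i j => (hcomm i j).map (MonoidHom.fst _ _)) hR
    hasUnboundedTripods fun F hF => hi₀ ((hp i₀).1.eq_one_of_apply_eq_self hF)

theorem eq_one_of_forall_fst_eq_one [Nontrivial V]
    (hθ : ∀ r, ∃ v, ∀ w, θ (ofAdd w) = 1 → r < ‖v - w‖) (hp : ∀ i, p i ∈ twistedGroup θ)
    (hq : ∀ j, q j ∈ twistedGroup θ) (hcomm : ∀ i j, Commute (p i) (q j))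
    (hR : ∀ F G, ∃ i j, dist F ((p i * q j).1 0) ≤ R ∧ dist G ((p i * q j).2 0) ≤ R)
    (hp₁ : ∀ i, (p i).1 = 1) (i : ι) : p i = 1 := by
  by_contra hi
  have hfree : ∀ G, (p i).2 G ≠ G := fun G hG =>
    hi (eq_one_of_mem_twistedGroup (hp i) (F := 0) (by rw [hp₁]; rfl) hG)
  have hq₂ : ∀ j, (q j).2 = 1 :=
    isZeroHyperbolic.eq_one_of_cobounded (fun i j => (hcomm i j).map (MonoidHom.snd _ _))
      (fun G => (hR 0 G).imp fun _ => Exists.imp fun _ => And.right) hasUnboundedTripods hfree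
  have hker : ∀ j, θ (ofAdd ((q j).1 0).endpoint) = 1 := fun j =>
    HasLinearPart.eq_one_of_one (hq₂ j ▸ (hq j).2)
  obtain ⟨v, hv⟩ := hθ R
  obtain ⟨F, rfl⟩ := exists_endpoint_eq v
  obtain ⟨i', j, hF, -⟩ := hR F 0
  rw [Prod.fst_mul, hp₁, one_mul] at hF
  have hend := lipschitzWith_endpoint.dist_le_mul F ((q j).1 0)
  rw [NNReal.coe_one, one_mul, dist_eq_norm] at hend
  exact (hv _ (hker j)).not_ge (hend.trans hF)

theorem forall_eq_one_or (hθ : ∀ r, ∃ v, ∀ w, θ (ofAdd w) = 1 → r < ‖v - w‖)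
    (hp : ∀ i, p i ∈ twistedGroup θ) (hq : ∀ j, q j ∈ twistedGroup θ)
    (hcomm : ∀ i j, Commute (p i) (q j))
    (hR : ∀ F G, ∃ i j, dist F ((p i * q j).1 0) ≤ R ∧ dist G ((p i * q j).2 0) ≤ R) :
    (∀ i, p i = 1) ∨ ∀ j, q j = 1 := by
  obtain ⟨v, hv⟩ := hθ 0
  have : Nontrivial V := ⟨v, 0, sub_ne_zero.1 (norm_pos_iff.1 (hv 0 (map_one θ)))⟩
  refine (forall_fst_eq_one_or hp hcomm fun F =>
    (hR F 0).imp fun _ => Exists.imp fun _ => And.left).imp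
    (eq_one_of_forall_fst_eq_one hθ hp hq hcomm hR)
    (eq_one_of_forall_fst_eq_one hθ hq hp (fun j i => (hcomm i j).symm) (R := R) fun F G => ?_)
  obtain ⟨i, j, hij⟩ := hR F G
  exact ⟨j, i, (hcomm i j).eq ▸ hij⟩

end Irreducibility

theorem not_coboundedlyReducible_twistedGroup
    (hθ : ∀ r, ∃ v, ∀ w, θ (ofAdd w) = 1 → r < ‖v - w‖) :
    ¬ CoboundedlyReducible (twistedGroup θ) (WithLp 1 (ReducedPath V × ReducedPath V)) := by
  rintro ⟨H, ⟨A, B, _, _, _, _, ⟨e⟩⟩, hH⟩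
  obtain ⟨R, hR⟩ := hH.exists_dist_le 0 0
  let ρ : A × B →* (ReducedPath V ≃ᵢ ReducedPath V) × (ReducedPath V ≃ᵢ ReducedPath V) :=
    (twistedGroup θ).subtype.comp (H.subtype.comp e.symm.toMonoidHom)
  have hρ : Function.Injective ρ :=
    Subtype.val_injective.comp (Subtype.val_injective.comp e.symm.injective)
  have hAB : (∀ a : A, ρ (a, 1) = 1) ∨ ∀ b : B, ρ (1, b) = 1 := by
    refine forall_eq_one_or hθ (fun a => (e.symm (a, 1)).1.2) (fun b => (e.symm (1, b)).1.2)
      (fun a b => (MonoidHom.commute_inl_inr a b).map ρ) (R := R) fun F G => ?_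
    obtain ⟨h, hFG⟩ := hR F G
    refine ⟨(e h).1, (e h).2, ?_⟩
    rwa [← map_mul, Prod.fst_mul_snd, show ρ (e h) = h.1.1 from by simp [ρ]]
  rcases hAB with hA | hB
  · obtain ⟨a, ha⟩ := exists_ne (1 : A)
    exact ha (congrArg Prod.fst (hρ ((hA a).trans (map_one ρ).symm)))
  · obtain ⟨b, hb⟩ := exists_ne (1 : B)
    exact hb (congrArg Prod.snd (hρ ((hB b).trans (map_one ρ).symm)))

section EssentialReducibility

variable {a : V} (ha : a ≠ 0) (hθ : θ (ofAdd a) = 1)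

include ha hθ

theorem exists_inl_mem_isBetween (F G : ReducedPath V) :
    ∃ g h : ReducedPath V ≃ᵢ ReducedPath V,
      MonoidHom.inl _ _ g ∈ twistedGroup θ ∧ MonoidHom.inl _ _ h ∈ twistedGroup θ ∧
        IsBetween (g F) G (h F) := by
  have hinj : Function.Injective fun n : ℕ => F.endpoint - G.endpoint + (n : ℝ) • a :=
    (add_right_injective _).comp ((smul_left_injective ℝ ha).comp Nat.cast_injective)
  obtain ⟨_, ⟨⟨m, rfl⟩, hm⟩, _, ⟨⟨n, rfl⟩, hn⟩, hmn⟩ :=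
    ((Set.infinite_range_of_injective hinj).sdiff (Set.finite_singleton 0)).nontrivial
  have hspoke : ∀ (k : ℕ) (l : ℝ) (hk : F.endpoint - G.endpoint + (k : ℝ) • a ≠ 0)
      (hl : ‖F.endpoint - G.endpoint + (k : ℝ) • a‖ ≤ l), ∃ g : ReducedPath V ≃ᵢ ReducedPath V,
        MonoidHom.inl _ _ g ∈ twistedGroup θ ∧ g F = G.spoke hk hl := by
    intro k l hk hl
    obtain ⟨g, hg, hgF⟩ := exists_hasLinearPart_apply_eq 1 F (G.spoke hk hl)
    have hg0 := hg.endpoint_apply F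
    rw [hgF, endpoint_spoke, ← add_assoc, add_sub_cancel] at hg0
    refine ⟨g, inl_mem_twistedGroup hg ?_, hgF⟩
    rw [← add_left_cancel hg0, Nat.cast_smul_eq_nsmul, ofAdd_nsmul, map_pow, hθ, one_pow]
  obtain ⟨g, hg, hgF⟩ := hspoke m _ hm (le_max_left _ _)
  obtain ⟨h, hh, hhF⟩ := hspoke n _ hn (le_max_right _ _)
  refine ⟨g, h, hg, hh, ?_⟩
  rw [hgF, hhF]
  exact isBetween_spoke G hm hn _ _ hmn

theorem splitsNontrivially_rectangularPart :
    SplitsNontrivially ((rectangularPart (twistedGroup θ)).subgroupOf (twistedGroup θ)) := by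
  obtain ⟨F, rfl⟩ := exists_endpoint_eq a
  have hF : HasLinearPart F.translate 1 := hasLinearPart_translate F
  have hF1 : F.translate ≠ 1 := fun h => ha (by
    rw [← translate_zero F, h, IsometryEquiv.coe_one, id, endpoint_zero])
  rw [← translate_zero F] at hθ
  exact ⟨_, _, inferInstance, inferInstance,
    ⟨⟨F.translate, inl_mem_twistedGroup hF hθ⟩, 1, fun h => hF1 (congrArg Subtype.val h)⟩,
    ⟨⟨F.translate, inr_mem_twistedGroup hF⟩, 1, fun h => hF1 (congrArg Subtype.val h)⟩,
    ⟨(Subgroup.subgroupOfEquivOfLe (rectangularPart_le _)).trans (Subgroup.prodEquiv _ _)⟩⟩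

theorem isEssentialAction_rectangularPart :
    IsEssentialAction ((rectangularPart (twistedGroup θ)).subgroupOf (twistedGroup θ))
      (WithLp 1 (ReducedPath V × ReducedPath V)) := by
  rintro C ⟨x, hx⟩ hconv hinv
  refine Set.eq_univ_of_forall fun y => ?_
  obtain ⟨t, ht, hty⟩ := exists_hasLinearPart_apply_eq 1 x.snd y.snd
  have hmem : ∀ g, MonoidHom.inl _ _ g ∈ twistedGroup θ →
      WithLp.toLp 1 (g x.fst, y.snd) ∈ C := fun g hg => by
    have hgt : (g, t) ∈ rectangularPart (twistedGroup θ) := ⟨hg, inr_mem_twistedGroup ht⟩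
    rw [← hty]
    exact hinv ⟨⟨(g, t), rectangularPart_le _ hgt⟩, hgt⟩ x hx
  obtain ⟨g, h, hg, hh, hgh⟩ := exists_inl_mem_isBetween ha hθ x.fst y.fst
  refine hconv _ (hmem g hg) _ (hmem h hh) y ?_
  simpa only [IsBetween, dist_prod_one, WithLp.toLp_fst, WithLp.toLp_snd, dist_self,
    add_zero] using hgh

theorem essentiallyReducible_twistedGroup :
    EssentiallyReducible (twistedGroup θ) (WithLp 1 (ReducedPath V × ReducedPath V)) :=
  ⟨_, splitsNontrivially_rectangularPart ha hθ, isEssentialAction_rectangularPart ha hθ⟩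

end EssentialReducibility

end TwistedGroup

end ReducedPath

/-! ### Irrational rotations -/

section IrrationalRotation

open Multiplicative (ofAdd toAdd)

/-- The torus acting on `ℂ × ℂ` by rotations of the two factors. -/
noncomputable def torusRotation : Circle × Circle →* ((ℂ × ℂ) ≃ₗᵢ[ℝ] (ℂ × ℂ)) where
  toFun c :=
    { toLinearEquiv := (rotation c.1).toLinearEquiv.prodCongr (rotation c.2).toLinearEquiv
      norm_map' := fun z =>
        congrArg₂ max ((rotation c.1).norm_map z.1) ((rotation c.2).norm_map z.2) }
  map_one' := by ext z <;> exact one_mul _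
  map_mul' c d := by ext z <;> exact mul_assoc _ _ _

theorem torusRotation_injective : Function.Injective torusRotation := fun _ _ h =>
  Prod.ext
    (rotation_injective (LinearIsometryEquiv.ext fun z =>
      congrArg Prod.fst (DFunLike.congr_fun h (z, 0))))
    (rotation_injective (LinearIsometryEquiv.ext fun z =>
      congrArg Prod.snd (DFunLike.congr_fun h (0, z))))

/-- The one-parameter subgroup of the torus of slope `√2`. The slope is irrational to make it
injective. -/
noncomputable def irrationalWinding : Multiplicative ℝ →* Circle × Circle :=
  MonoidHom.mk' (fun t => (Circle.exp t.toAdd, Circle.exp (√2 * t.toAdd))) fun s t => by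
    rw [toAdd_mul, mul_add, Circle.exp_add, Circle.exp_add, Prod.mk_mul_mk]

theorem irrationalWinding_injective : Function.Injective irrationalWinding := by
  refine (injective_iff_map_eq_one _).2 fun t ht => ?_
  obtain ⟨m, hm⟩ := Circle.exp_eq_one.1 (congrArg Prod.fst ht)
  obtain ⟨n, hn⟩ := Circle.exp_eq_one.1 (congrArg Prod.snd ht)
  rw [hm, ← mul_assoc] at hn
  rcases eq_or_ne m 0 with rfl | hm0
  · simpa using hm
  · exact absurd (mul_right_cancel₀ Real.two_pi_pos.ne' hn)
      ((irrational_sqrt_two.mul_intCast hm0).ne_int n)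

/-- The action of `ℂ × ℂ` on itself in which `v` rotates the two factors by the angles `t` and
`√2 * t`, where `t` is the real part of the first component of `v`. -/
noncomputable def irrationalRotation : Multiplicative (ℂ × ℂ) →* ((ℂ × ℂ) ≃ₗᵢ[ℝ] (ℂ × ℂ)) :=
  (torusRotation.comp irrationalWinding).comp
    (Complex.reAddGroupHom.comp (AddMonoidHom.fst ℂ ℂ)).toMultiplicative

theorem irrationalRotation_eq_one_iff {v : ℂ × ℂ} :
    irrationalRotation (ofAdd v) = 1 ↔ v.1.re = 0 := by
  have hinj : Function.Injective (torusRotation.comp irrationalWinding) :=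
    torusRotation_injective.comp irrationalWinding_injective
  exact map_eq_one_iff _ hinj

theorem exists_lt_norm_sub_of_irrationalRotation_eq_one (r : ℝ) :
    ∃ v : ℂ × ℂ, ∀ w, irrationalRotation (ofAdd w) = 1 → r < ‖v - w‖ := by
  refine ⟨((r + 1 : ℝ), 0), fun w hw => ?_⟩
  calc r < r + 1 - w.1.re := by rw [irrationalRotation_eq_one_iff.1 hw]; linarith
    _ = (((r + 1 : ℝ) : ℂ) - w.1).re := by simp
    _ ≤ ‖((r + 1 : ℝ) : ℂ) - w.1‖ := Complex.re_le_norm _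
    _ ≤ _ := norm_fst_le (((r + 1 : ℝ) : ℂ) - w.1, 0 - w.2)

end IrrationalRotation

open ReducedPath in
theorem corollaryC :
    ∃ (T : Type) (_ : MetricSpace T),
      Nonempty T ∧ CompleteSpace T ∧ IsRealTree T ∧ HasValence T Cardinal.continuum ∧
      ∃ G : Subgroup ((T ≃ᵢ T) × (T ≃ᵢ T)),
        IsIsometricSMul G (WithLp 1 (T × T)) ∧
        (∀ (g : G) (p : WithLp 1 (T × T)), g • p = p → g = 1) ∧
        MulAction.IsPretransitive G (WithLp 1 (T × T)) ∧
        ¬ CoboundedlyReducible G (WithLp 1 (T × T)) ∧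
        EssentiallyReducible G (WithLp 1 (T × T)) := by
  have hcard : #(ℂ × ℂ) ≤ 𝔠 := by simp
  have ha : ((0, 1) : ℂ × ℂ) ≠ 0 := by simp
  refine ⟨ReducedPath (ℂ × ℂ), inferInstance, ⟨0⟩, inferInstance, isZeroHyperbolic.isRealTree,
    hasValence hcard, twistedGroup irrationalRotation, inferInstance, fun g x hgx => ?_,
    ⟨fun x y => ?_⟩,
    not_coboundedlyReducible_twistedGroup exists_lt_norm_sub_of_irrationalRotation_eq_one,
    essentiallyReducible_twistedGroup ha (irrationalRotation_eq_one_iff.2 Complex.zero_re)⟩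
  · exact Subtype.ext (eq_one_of_mem_twistedGroup g.2 (congrArg WithLp.fst hgx)
      (congrArg WithLp.snd hgx))
  · obtain ⟨g, hg, hfst, hsnd⟩ := exists_mem_twistedGroup_apply_eq x.fst y.fst x.snd y.snd
    exact ⟨⟨g, hg⟩, congrArg (WithLp.toLp 1) (Prod.ext hfst hsnd)⟩
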